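/- **Setup.** There are $K$ data streams. Stream $a\in[K]=\{1,\dots,K\}$ has a pre-change density $f_{a,0}$ and a post-change density $f_{a,1}$ with respect to a common dominating measure $\lambda$; $f_{a,0}$ and $f_{a,1}$ vanish at the same points, up to a $\lambda$-null set, so that log-likelihood ratios are finite. The observations $X_{a,n}$ ($a\in[K]$, $n\ge 1$) are mutually independent. For a change-point $\nu\in\mathbb N=\{1,2,\dots\}$ and a set $\mathcal A\subseteq[K]$ of affected streams, $X_{a,n}$ has density $f_{a,1}$ under $\mathbb P_{\nu,\mathcal A}$ if $n\ge\nu$ and $a\in\mathcal A$, and density $f_{a,0}$ otherwise; under $\mathbb P_\infty$ all $X_{a,n}$ have density $f_{a,0}$. Write $\mathrm{LLR}(a,x)=\log\big(f_{a,1}(x)/f_{a,0}(x)\big)$ and $D(f_{a,1}\|f_{a,0})=\int \log(f_{a,1}/f_{a,0})\,f_{a,1}\,d\lambda$. Assume that for every $a\in[K]$, $D(f_{a,1}\|f_{a,0})>0$ and, for a known constant $v<\infty$, $$\log\int \exp\!\Big(\theta\big(\log (f_{a,1}/f_{a,0})-D(f_{a,1}\|f_{a,0})\big)\Big)f_{a,1}\,d\lambda\le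 \frac v2\theta^2\qquad\text{for all }\theta\in\mathbb R .$$ **Procedure.** At each time-step $n\ge1$ one action $A_n\in[K]$ is chosen and $X_{A_n,n}$ is observed; let $\mathcal F_n=\sigma(X_{A_1,1},\dots,X_{A_n,n})$. Fix an interval length $W\ge1$ and let $m(n)=(\lceil n/W\rceil-1)W+1$ be the first time-step of the length-$W$ interval that contains $n$. Let $N_a$ be the number of $i\in\{m(n),\dots,n-1\}$ with $A_i=a$, and let $\hat\mu_a$ be the average of $\mathrm{LLR}(a,X_{a,i})$ over these $i$. The UCB policy $A_{\mathrm{UCB}}$ chooses $$A_n\in\operatorname*{argmax}_{a\in[K]}\Big(\hat\mu_a+\sqrt{4v\log W/N_a}\Big),$$ where the index is $+\infty$ if $N_a=0$ and ties are broken by a fixed rule, which depends only on the set of maximizers. Let $C_0=0$, $C_n=\max\{C_{n-1},0\}+\mathrm{LLR}(A_n,X_{A_n,n})$, and $T_b=\inf\{n\ge1: C_n\ge b\}$. Lorden's worst-case delay is $$\mathcal J_{\mathcal A}(A,T)=\sup_{\nu\ge1}\operatorname{ess\,sup}\ \mathbb E_{\nu,\mathcal A}\big[(T-\nu+1)^+\,\big|\,\mathcal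 F_{\nu-1}\big].$$ **Theorem.** Let $b=\log\gamma$. 1. For all $\gamma>0$ and all $W\ge1$, $\mathbb E_\infty[T_b]\ge\gamma$. 2. For every nonempty $\mathcal A\subseteq[K]$, as $\gamma,W\to\infty$ with $W=o(\log\gamma)$, $$\mathcal J_{\mathcal A}(A_{\mathrm{UCB}},T_b)\le\frac{\log\gamma}{I_{\mathcal A}}\,(1+o(1)),\qquad I_{\mathcal A}=\max_{a\in\mathcal A}D(f_{a,1}\|f_{a,0}).$$ -/

import Mathlib

open MeasureTheory ProbabilityTheory Filter Topology
open scoped ENNReal NNReal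

noncomputable section

namespace BanditQCD

/-- `K` data streams with values in `𝓧`, each with a pre-change density `pre a` and a post-change
density `post a` with respect to a common dominating measure `base`. -/
structure Channels (K : ℕ) (𝓧 : Type*) [MeasurableSpace 𝓧] where
  base : Measure 𝓧
  pre : Fin K → 𝓧 → ℝ
  post : Fin K → 𝓧 → ℝ
  measurable_pre : ∀ a, Measurable (pre a)
  measurable_post : ∀ a, Measurable (post a)
  pre_nonneg : ∀ a x, 0 ≤ pre a x
  post_nonneg : ∀ a x, 0 ≤ post a x
  lintegral_pre : ∀ a, ∫⁻ x, ENNReal.ofReal (pre a x) ∂base = 1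
  lintegral_post : ∀ a, ∫⁻ x, ENNReal.ofReal (post a x) ∂base = 1

/-- The sample space of all observations: `ω (n, a)` is the observation `X_{a,n}` of stream `a` at
time-step `n`. Time-steps are `n = 1, 2, …`; the coordinates with `n = 0` are never used. -/
abbrev Observations (K : ℕ) (𝓧 : Type*) : Type _ := ℕ × Fin K → 𝓧

variable {K : ℕ} {𝓧 : Type*} [MeasurableSpace 𝓧]

namespace Channels

/-- The pre-change distribution of stream `a`. -/
def preMeasure (M : Channels K 𝓧) (a : Fin K) : Measure 𝓧 :=
  M.base.withDensity fun x => ENNReal.ofReal (M.pre a x)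

/-- The post-change distribution of stream `a`. -/
def postMeasure (M : Channels K 𝓧) (a : Fin K) : Measure 𝓧 :=
  M.base.withDensity fun x => ENNReal.ofReal (M.post a x)

instance (M : Channels K 𝓧) (a : Fin K) : IsProbabilityMeasure (M.preMeasure a) :=
  ⟨by simp [preMeasure, M.lintegral_pre a]⟩

instance (M : Channels K 𝓧) (a : Fin K) : IsProbabilityMeasure (M.postMeasure a) :=
  ⟨by simp [postMeasure, M.lintegral_post a]⟩

/-- The log-likelihood ratio `LLR(a, x)`. -/
def llr (M : Channels K 𝓧) (a : Fin K) (x : 𝓧) : ℝ :=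
  Real.log (M.post a x / M.pre a x)

lemma measurable_llr (M : Channels K 𝓧) (a : Fin K) : Measurable (M.llr a) :=
  Real.measurable_log.comp ((M.measurable_post a).div (M.measurable_pre a))

/-- The Kullback-Leibler divergence `D(f_{a,1} || f_{a,0})`. -/
def kl (M : Channels K 𝓧) (a : Fin K) : ℝ :=
  ∫ x, Real.log (M.post a x / M.pre a x) * M.post a x ∂M.base

/-- The largest divergence over a nonempty set of streams. -/
def maxKl (M : Channels K 𝓧) (𝒜 : Finset (Fin K)) (h𝒜 : 𝒜.Nonempty) : ℝ :=
  𝒜.sup' h𝒜 M.kl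

/-- The law of the observations when the streams in `𝒜` change at time-step `ν`: all observations
are independent, and `X_{a,n}` has the post-change law iff `n ≥ ν` and `a ∈ 𝒜`. -/
def law (M : Channels K 𝓧) (𝒜 : Finset (Fin K)) (ν : ℕ) : Measure (Observations K 𝓧) :=
  Measure.infinitePi fun p : ℕ × Fin K =>
    if ν ≤ p.1 ∧ p.2 ∈ 𝒜 then M.postMeasure p.2 else M.preMeasure p.2

/-- The law of the observations when no change occurs. -/
def lawNoChange (M : Channels K 𝓧) : Measure (Observations K 𝓧) :=
  Measure.infinitePi fun p : ℕ × Fin K => M.preMeasure p.2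

instance (M : Channels K 𝓧) (𝒜 : Finset (Fin K)) (ν : ℕ) : IsProbabilityMeasure (M.law 𝒜 ν) := by
  have h : ∀ p : ℕ × Fin K, IsProbabilityMeasure
      (if ν ≤ p.1 ∧ p.2 ∈ 𝒜 then M.postMeasure p.2 else M.preMeasure p.2) := by
    intro p
    split_ifs <;> infer_instance
  unfold law
  infer_instance

instance (M : Channels K 𝓧) : IsProbabilityMeasure M.lawNoChange := by
  unfold lawNoChange
  infer_instance

end Channels

/-- `ℱ_n = σ(X_{A_1,1}, …, X_{A_n,n})`, the information collected up to time-step `n` when the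
actions are `A_1, A_2, …`. -/
@[reducible] def history (A : ℕ → Observations K 𝓧 → Fin K) (n : ℕ) : MeasurableSpace (Observations K 𝓧) :=
  ⨆ i ∈ Finset.Icc 1 n, MeasurableSpace.comap (fun ω => ω (i, A i ω)) inferInstance

/-- A control policy: actions `A_1, A_2, …` such that `A_n` is `ℱ_{n-1}`-measurable.
(The value `act 0` is never used.) -/
structure ControlPolicy (K : ℕ) (𝓧 : Type*) [MeasurableSpace 𝓧] where
  act : ℕ → Observations K 𝓧 → Fin K
  adapted : ∀ n, 1 ≤ n → Measurable[history act (n - 1)] (act n)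

/-- The CuSum-like statistic `C_0 = 0`, `C_n = (C_{n-1})⁺ + LLR(A_n, X_{A_n,n})`. -/
def cusum (M : Channels K 𝓧) (A : ControlPolicy K 𝓧) : ℕ → Observations K 𝓧 → ℝ
  | 0, _ => 0
  | n + 1, ω => max (cusum M A n ω) 0 + M.llr (A.act (n + 1) ω) (ω (n + 1, A.act (n + 1) ω))

/-- The alarm time `T_b = inf {n ≥ 1 : C_n ≥ b}`, infinite if the threshold is never reached. -/
def alarmTime (M : Channels K 𝓧) (A : ControlPolicy K 𝓧) (b : ℝ) : Observations K 𝓧 → ℕ∞ :=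
  hittingAfter (cusum M A) (Set.Ici b) 1

/-- The mean time to false alarm `𝔼_∞[T]`. -/
def meanTimeToFalseAlarm (M : Channels K 𝓧) (T : Observations K 𝓧 → ℕ∞) : ℝ≥0∞ :=
  ∫⁻ ω, (T ω : ℝ≥0∞) ∂M.lawNoChange

/-- Lorden's worst-case delay `sup_{ν ≥ 1} ess sup 𝔼_ν[(T - ν + 1)⁺ | ℱ_{ν-1}]`. The positive part
is the truncated subtraction of `ℝ≥0∞`. -/
def worstCaseDelay (M : Channels K 𝓧) (𝒜 : Finset (Fin K)) (A : ControlPolicy K 𝓧)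
    (T : Observations K 𝓧 → ℕ∞) : ℝ≥0∞ :=
  ⨆ (ν : ℕ) (_ : 1 ≤ ν),
    essSup (condLExp (history A.act (ν - 1)) (M.law 𝒜 ν) fun ω => (T ω : ℝ≥0∞) + 1 - (ν : ℝ≥0∞))
      (M.law 𝒜 ν)

/-! ### The UCB rule with restarts every `W` time-steps

For time-step `n ≥ 1` the statistics below use the time-steps before `n` that lie in the same
interval `{(j - 1) W + 1, …, j W}` as `n`. Here `α i` is the action at time-step `i`. -/

/-- The first time-step of the interval that contains `n ≥ 1`. -/
def intervalStart (W n : ℕ) : ℕ := (n - 1) / W * W + 1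

/-- The number of times `a` has been selected in the current interval, before time-step `n`. -/
def pulls (W : ℕ) (α : ℕ → Fin K) (n : ℕ) (a : Fin K) : ℕ :=
  ∑ i ∈ Finset.Ico (intervalStart W n) n, if α i = a then 1 else 0

/-- The mean reward of `a` in the current interval, before time-step `n`
(equal to `0` if `a` has not been selected). -/
def meanReward (M : Channels K 𝓧) (W : ℕ) (ω : Observations K 𝓧) (α : ℕ → Fin K) (n : ℕ)
    (a : Fin K) : ℝ :=
  (∑ i ∈ Finset.Ico (intervalStart W n) n, if α i = a then M.llr (α i) (ω (i, α i)) else 0) /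
    (pulls W α n a : ℝ)

/-- The UCB index of `a` used for choosing the action at time-step `n`
(equal to `∞` if `a` has not been selected). -/
def ucbIndex (M : Channels K 𝓧) (v : ℝ≥0) (W : ℕ) (ω : Observations K 𝓧) (α : ℕ → Fin K) (n : ℕ)
    (a : Fin K) : EReal :=
  if pulls W α n a = 0 then ⊤
  else ((meanReward M W ω α n a + √(4 * (v : ℝ) * Real.log W / (pulls W α n a : ℝ)) : ℝ) : EReal)

open scoped Classical in
/-- The set of actions with the largest UCB index. -/
def ucbArgmax (M : Channels K 𝓧) (v : ℝ≥0) (W : ℕ) (ω : Observations K 𝓧) (α : ℕ → Fin K)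
    (n : ℕ) : Finset (Fin K) :=
  Finset.univ.filter fun a => ∀ a', ucbIndex M v W ω α n a' ≤ ucbIndex M v W ω α n a

/-- The UCB actions: at each time-step an action with the largest index, ties being broken
by the rule `tie`. The actions at time-steps `≥ n` do not enter the indices for time-step `n`. -/
def ucbAct (M : Channels K 𝓧) (v : ℝ≥0) (W : ℕ) (tie : Finset (Fin K) → Fin K)
    (n : ℕ) (ω : Observations K 𝓧) : Fin K :=
  tie (ucbArgmax M v W ω
    (fun i => if _h : i < n then ucbAct M v W tie i ω else tie Finset.univ) n)
termination_by n
decreasing_by exact _h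

lemma ucbArgmax_congr (M : Channels K 𝓧) (v : ℝ≥0) (W : ℕ) (ω : Observations K 𝓧)
    {α β : ℕ → Fin K} {n : ℕ} (h : ∀ i < n, α i = β i) :
    ucbArgmax M v W ω α n = ucbArgmax M v W ω β n := by
  have hp : ∀ a, pulls W α n a = pulls W β n a := fun a =>
    Finset.sum_congr rfl fun i hi => by rw [h i (Finset.mem_Ico.1 hi).2]
  have hm : ∀ a, meanReward M W ω α n a = meanReward M W ω β n a := by
    intro a
    unfold meanReward
    rw [hp a]
    congr 1
    exact Finset.sum_congr rfl fun i hi => by rw [h i (Finset.mem_Ico.1 hi).2]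
  have hi : ∀ a, ucbIndex M v W ω α n a = ucbIndex M v W ω β n a := by
    intro a
    unfold ucbIndex
    rw [hp a, hm a]
  unfold ucbArgmax
  simp only [hi]

/-- The action at time-step `n` maximizes the UCB index computed from the earlier actions. -/
lemma ucbAct_eq (M : Channels K 𝓧) (v : ℝ≥0) (W : ℕ) (tie : Finset (Fin K) → Fin K)
    (n : ℕ) (ω : Observations K 𝓧) :
    ucbAct M v W tie n ω = tie (ucbArgmax M v W ω (fun i => ucbAct M v W tie i ω) n) := by
  rw [ucbAct]
  congr 1
  refine ucbArgmax_congr M v W ω fun i hi => ?_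
  simp [hi]

lemma history_mono (A : ℕ → Observations K 𝓧 → Fin K) {m n : ℕ} (h : m ≤ n) :
    history A m ≤ history A n :=
  biSup_mono fun _ hi => Finset.Icc_subset_Icc_right h hi

lemma measurable_obs (A : ℕ → Observations K 𝓧 → Fin K) {i n : ℕ} (hi : 1 ≤ i) (hn : i ≤ n) :
    Measurable[history A n] fun ω => ω (i, A i ω) := by
  have h : MeasurableSpace.comap (fun ω : Observations K 𝓧 => ω (i, A i ω)) inferInstance ≤
      history A n :=
    le_iSup₂_of_le i (Finset.mem_Icc.2 ⟨hi, hn⟩) le_rfl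
  exact measurable_iff_comap_le.2 h

/-- The UCB actions depend only on the past observations. -/
lemma ucbAct_adapted (M : Channels K 𝓧) (v : ℝ≥0) (W : ℕ) (tie : Finset (Fin K) → Fin K)
    (n : ℕ) : Measurable[history (ucbAct M v W tie) (n - 1)] (ucbAct M v W tie n) := by
  induction n using Nat.strong_induction_on with
  | _ n ih =>
    set A := ucbAct M v W tie with hA
    let m : MeasurableSpace (Observations K 𝓧) := history A (n - 1)
    have hact : ∀ i ∈ Finset.Ico (intervalStart W n) n, Measurable[m] (A i) := by
      intro i hi
      have hi' := Finset.mem_Ico.1 hi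
      exact (ih i hi'.2).mono (history_mono A (by omega)) le_rfl
    have heq : ∀ i ∈ Finset.Ico (intervalStart W n) n, ∀ a,
        MeasurableSet[m] {ω | A i ω = a} := fun i hi a =>
      (hact i hi) (measurableSet_singleton a)
    have hpull : ∀ a, Measurable[m] fun ω => pulls W (fun i => A i ω) n a := by
      intro a
      unfold pulls
      exact Finset.measurable_fun_sum _ fun i hi =>
        Measurable.ite (heq i hi a) measurable_const measurable_const
    have hrew : ∀ a, Measurable[m] fun ω => meanReward M W ω (fun i => A i ω) n a := by
      intro a
      unfold meanReward
      refine Measurable.div (Finset.measurable_fun_sum _ fun i hi => ?_)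
        ((measurable_from_top (f := fun k : ℕ => (k : ℝ))).comp (hpull a))
      have hi' := Finset.mem_Ico.1 hi
      have h1 : 1 ≤ i := by
        have := hi'.1
        unfold intervalStart at this
        omega
      have hobs : Measurable[m] fun ω => ω (i, A i ω) := measurable_obs A h1 (by omega)
      have h2 : Measurable[m] fun ω : Observations K 𝓧 =>
          if A i ω = a then M.llr a (ω (i, A i ω)) else 0 :=
        Measurable.ite (heq i hi a) ((M.measurable_llr a).comp hobs) measurable_const
      refine Eq.mpr ?_ h2
      congr 1
      funext ω
      by_cases h : A i ω = a
      · simp [h]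
      · simp [h]
    have hidx : ∀ a, Measurable[m] fun ω => ucbIndex M v W ω (fun i => A i ω) n a := by
      intro a
      unfold ucbIndex
      refine Measurable.ite ((hpull a) (measurableSet_singleton 0)) measurable_const ?_
      refine measurable_coe_real_ereal.comp ((hrew a).add ?_)
      exact (measurable_from_top
        (f := fun k : ℕ => √(4 * (v : ℝ) * Real.log W / (k : ℝ)))).comp (hpull a)
    have hmem : ∀ a, MeasurableSet[m] {ω | a ∈ ucbArgmax M v W ω (fun i => A i ω) n} := by
      intro a
      simp only [ucbArgmax, Finset.mem_filter, Finset.mem_univ, true_and, Set.ofPred_forall]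
      exact MeasurableSet.iInter fun a' => measurableSet_le (hidx a') (hidx a)
    have harg : ∀ s : Finset (Fin K),
        MeasurableSet[m] {ω | ucbArgmax M v W ω (fun i => A i ω) n = s} := by
      intro s
      have : {ω | ucbArgmax M v W ω (fun i => A i ω) n = s} =
          ⋂ a, {ω | a ∈ ucbArgmax M v W ω (fun i => A i ω) n ↔ a ∈ s} := by
        ext ω
        simp [Finset.ext_iff]
      rw [this]
      refine MeasurableSet.iInter fun a => ?_
      by_cases ha : a ∈ s
      · simpa [ha] using hmem a
      · have hc : MeasurableSet[m] {ω | a ∉ ucbArgmax M v W ω (fun i => A i ω) n} :=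
          (hmem a).compl
        simpa [ha] using hc
    refine measurable_to_countable' fun a => ?_
    have : A n ⁻¹' {a} = ⋃ s ∈ {s : Finset (Fin K) | tie s = a},
        {ω | ucbArgmax M v W ω (fun i => A i ω) n = s} := by
      ext ω
      simp [hA, ucbAct_eq M v W tie n ω]
    rw [this]
    exact MeasurableSet.biUnion (Set.to_countable _) fun s _ => harg s

/-- The control policy `A_UCB`: the UCB rule, restarted every `W` time-steps, with the
log-likelihood ratios of the observations as rewards. -/
def ucbPolicy (M : Channels K 𝓧) (v : ℝ≥0) (W : ℕ) (tie : Finset (Fin K) → Fin K) :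
    ControlPolicy K 𝓧 where
  act := ucbAct M v W tie
  adapted n _ := ucbAct_adapted M v W tie n

end BanditQCD

end

/-!
Before a change, the Shiryaev-Roberts statistic `R_n = (1 + R_{n-1}) exp LLR(A_n, X_{A_n,n})` has
conditional drift `1` whatever the policy, and it dominates `exp C_n`. Optional stopping therefore
gives `𝔼_∞[T_b] ≥ exp b`.

After a change, `C_n` dominates the random walk of the log-likelihood ratios observed since any
earlier time-step. In each interval that starts after the change the UCB rule selects a stream that
is unaffected, or whose divergence is below `I = max_{a ∈ 𝒜} D(f_{a,1} ‖ f_{a,0})`, only `o(W)`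
times in expectation, by Chernoff bounds for its mean reward and for the index of a best affected
stream. So the sum of the log-likelihood ratios over such an interval has conditional mean at least
`m W` for any `m < I` and large `W`. Capping the log-likelihood ratios at a constant `B` preserves
this and bounds the overshoot, and Wald's inequality gives an expected number of intervals of at
most `(b + W B) / (m W)` until the walk reaches `b`. Since `W = o(b)`, the delay is
`b / I (1 + o(1))`.
-/

noncomputable section

namespace BanditQCD

variable {K : ℕ} {𝓧 : Type*} [MeasurableSpace 𝓧]

namespace ControlPolicy

variable {β : Type*} (A : ControlPolicy K 𝓧)

/-- The value of the stream-dependent function `f` at the observation `X_{A_i,i}` made at time-step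
`i`, such as its log-likelihood ratio. -/
def observed (f : Fin K → 𝓧 → β) (i : ℕ) (ω : Observations K 𝓧) : β :=
  f (A.act i ω) (ω (i, A.act i ω))

lemma measurable_act {i n : ℕ} (hi : 1 ≤ i) (hn : i ≤ n + 1) :
    Measurable[history A.act n] (A.act i) :=
  (A.adapted i hi).mono (history_mono A.act (by omega)) le_rfl

lemma measurableSet_act_eq (n : ℕ) (a : Fin K) :
    MeasurableSet[history A.act n] (A.act (n + 1) ⁻¹' {a}) :=
  A.measurable_act n.succ_pos le_rfl (measurableSet_singleton a)

lemma iUnion_act_eq (n : ℕ) : ⋃ a, A.act (n + 1) ⁻¹' {a} = Set.univ := by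
  rw [← Set.preimage_iUnion, Set.iUnion_of_singleton, Set.preimage_univ]

lemma measurable_observed [MeasurableSpace β] {f : Fin K → 𝓧 → β} (hf : ∀ a, Measurable (f a))
    {i n : ℕ} (hi : 1 ≤ i) (hn : i ≤ n) : Measurable[history A.act n] (A.observed f i) :=
  (measurable_from_prod_countable_right (f := fun y : Fin K × 𝓧 => f y.1 y.2) hf).comp
    ((A.measurable_act hi (by omega)).prodMk (measurable_obs A.act hi hn))

lemma history_le_iSup_comap (n : ℕ) :
    history A.act n ≤ ⨆ p ∈ {p : ℕ × Fin K | p.1 ≤ n},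
      MeasurableSpace.comap (fun ω : Observations K 𝓧 => ω p) inferInstance := by
  induction n with
  | zero => exact iSup₂_le fun i hi => by simp at hi
  | succ n ih =>
    refine iSup₂_le fun i hi => measurable_iff_comap_le.1 ?_
    obtain ⟨hi₁, hi₂⟩ := Finset.mem_Icc.1 hi
    have h_act := (A.measurable_act hi₁ hi₂).mono
      (ih.trans (biSup_mono fun _ hp => Nat.le_succ_of_le hp)) le_rfl
    refine measurable_from_prod_countable_left
      (f := fun y : Observations K 𝓧 × Fin K => y.1 (i, y.2)) (fun a => ?_) |>.comp
      (measurable_id.prodMk h_act)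
    exact measurable_iff_comap_le.2 (le_iSup₂_of_le (i, a) hi₂ le_rfl)

lemma history_le (n : ℕ) : history A.act n ≤ MeasurableSpace.pi :=
  (A.history_le_iSup_comap n).trans
    (iSup₂_le fun p _ => (measurable_pi_apply p).comap_le)

lemma measurable_act_of_pos {n : ℕ} (hn : 1 ≤ n) : Measurable (A.act n) :=
  (A.measurable_act hn n.le_succ).mono (A.history_le n) le_rfl

end ControlPolicy

/-- Under the finite measure `Q`, every observation of a stream `a` after time-step `t` has law
`q a` and is independent of the history before it. Conditioning on an event `G` is expressed by
passing to `Q.restrict G`, so `Q` need not have total mass `1`. -/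
def FreshAfter (A : ControlPolicy K 𝓧) (q : Fin K → Measure 𝓧) (t : ℕ)
    (Q : Measure (Observations K 𝓧)) : Prop :=
  ∀ n ≥ t, ∀ a G, MeasurableSet[history A.act n] G →
    (Q.restrict G).map (fun ω => ω (n + 1, a)) = Q G • q a

lemma freshAfter_infinitePi (A : ControlPolicy K 𝓧) {q : Fin K → Measure 𝓧} {t : ℕ}
    (p : ℕ × Fin K → Measure 𝓧) [∀ i, IsProbabilityMeasure (p i)]
    (hp : ∀ n > t, ∀ a, p (n, a) = q a) : FreshAfter A q t (Measure.infinitePi p) := by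
  intro n hn a G hG
  have h_iIndep : iIndep (fun i : ℕ × Fin K =>
      MeasurableSpace.comap (fun ω : Observations K 𝓧 => ω i) inferInstance)
      (Measure.infinitePi p) :=
    iIndepFun_infinitePi (P := p) (X := fun _ x => x) fun _ => measurable_id
  have h_indep := indep_iSup_of_disjoint (fun i => (measurable_pi_apply i).comap_le) h_iIndep
    (S := {i | i.1 ≤ n}) (T := {(n + 1, a)}) (by simp)
  ext B hB
  have hX : Measurable fun ω : Observations K 𝓧 => ω (n + 1, a) := measurable_pi_apply _
  have h_inter := (Indep_iff _ _ _).1 h_indep G ((fun ω => ω (n + 1, a)) ⁻¹' B)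
    (A.history_le_iSup_comap n G hG) (by
      rw [iSup_singleton]
      exact ⟨B, hB, rfl⟩)
  rw [Measure.map_apply hX hB, Measure.restrict_apply (hX hB), Set.inter_comm, h_inter,
    ← Measure.map_apply hX hB, (measurePreserving_eval_infinitePi p (n + 1, a)).map_eq,
    hp (n + 1) (by omega), Measure.smul_apply, smul_eq_mul]

namespace FreshAfter

variable {A : ControlPolicy K 𝓧} {q : Fin K → Measure 𝓧} {t : ℕ} {Q : Measure (Observations K 𝓧)}

lemma mono (hQ : FreshAfter A q t Q) {s : ℕ} (hts : t ≤ s) : FreshAfter A q s Q :=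
  fun n hn => hQ n (hts.trans hn)

lemma restrict (hQ : FreshAfter A q t Q) {G : Set (Observations K 𝓧)}
    (hG : MeasurableSet[history A.act t] G) : FreshAfter A q t (Q.restrict G) := by
  intro n hn a H hH
  have hG' : MeasurableSet[history A.act n] G := history_mono A.act hn _ hG
  rw [Measure.restrict_restrict (A.history_le n H hH), hQ n hn a _ (hH.inter hG'),
    Measure.restrict_apply (A.history_le n H hH)]

lemma lintegral_mul_eval (hQ : FreshAfter A q t Q) {n : ℕ} (hn : t ≤ n) (a : Fin K)
    {U : Observations K 𝓧 → ℝ≥0∞} (hU : Measurable[history A.act n] U)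
    {g : 𝓧 → ℝ≥0∞} (hg : Measurable g) :
    ∫⁻ ω, U ω * g (ω (n + 1, a)) ∂Q = (∫⁻ ω, U ω ∂Q) * ∫⁻ x, g x ∂q a := by
  have hX : Measurable fun ω : Observations K 𝓧 => ω (n + 1, a) := measurable_pi_apply _
  have hgX : Measurable fun ω : Observations K 𝓧 => g (ω (n + 1, a)) := hg.comp hX
  have hle := A.history_le n
  have h_mul {U : Observations K 𝓧 → ℝ≥0∞} (hU : Measurable[history A.act n] U) :
      Measurable fun ω => U ω * g (ω (n + 1, a)) := (hU.mono hle le_rfl).mul hgX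
  refine Measurable.ennreal_induction
    (motive := fun U => ∫⁻ ω, U ω * g (ω (n + 1, a)) ∂Q = (∫⁻ ω, U ω ∂Q) * ∫⁻ x, g x ∂q a)
    (fun c s hs => ?_) (fun U V _ hU _ ihU ihV => ?_) (fun U hU hmono ih => ?_) hU
  · have h_set : ∫⁻ ω in s, g (ω (n + 1, a)) ∂Q = Q s * ∫⁻ x, g x ∂q a := by
      rw [← lintegral_map hg hX, hQ n hn a s hs, lintegral_smul_measure, smul_eq_mul]
    simp_rw [← Set.indicator_mul_left s (fun _ => c) fun ω => g (ω (n + 1, a))]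
    rw [lintegral_indicator (hle s hs), lintegral_indicator_const (hle s hs),
      lintegral_const_mul c hgX, h_set, mul_assoc]
  · simp only [Pi.add_apply, add_mul]
    rw [lintegral_add_left (h_mul hU), lintegral_add_left (hU.mono hle le_rfl), add_mul, ihU, ihV]
  · simp only [ENNReal.iSup_mul]
    rw [lintegral_iSup (fun k => h_mul (hU k))
        fun _ _ h ω => mul_le_mul_left (hmono h ω) _,
      lintegral_iSup (fun k => (hU k).mono hle le_rfl) hmono, ENNReal.iSup_mul]
    exact iSup_congr ih

lemma setLIntegral_observed_mul (hQ : FreshAfter A q t Q) {n : ℕ} (hn : t ≤ n) (a : Fin K)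
    {U : Observations K 𝓧 → ℝ≥0∞} (hU : Measurable[history A.act n] U)
    {g : Fin K → 𝓧 → ℝ≥0∞} (hg : Measurable (g a)) :
    ∫⁻ ω in A.act (n + 1) ⁻¹' {a}, U ω * A.observed g (n + 1) ω ∂Q =
      (∫⁻ ω in A.act (n + 1) ⁻¹' {a}, U ω ∂Q) * ∫⁻ x, g a x ∂q a := by
  have h_act := A.measurableSet_act_eq n a
  rw [← (hQ.mono hn).restrict h_act |>.lintegral_mul_eval le_rfl a hU hg]
  refine setLIntegral_congr_fun (A.history_le n _ h_act) fun ω hω => ?_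
  rw [Set.mem_preimage, Set.mem_singleton_iff] at hω
  simp only [ControlPolicy.observed, hω]

lemma lintegral_mul_observed_le (hQ : FreshAfter A q t Q) {n : ℕ} (hn : t ≤ n)
    {U : Observations K 𝓧 → ℝ≥0∞} (hU : Measurable[history A.act n] U)
    {g : Fin K → 𝓧 → ℝ≥0∞} (hg : ∀ a, Measurable (g a)) (hg_le : ∀ a, ∫⁻ x, g a x ∂q a ≤ 1) :
    ∫⁻ ω, U ω * A.observed g (n + 1) ω ∂Q ≤ ∫⁻ ω, U ω ∂Q := by
  have h_split (V : Observations K 𝓧 → ℝ≥0∞) :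
      ∫⁻ ω, V ω ∂Q = ∑ a, ∫⁻ ω in A.act (n + 1) ⁻¹' {a}, V ω ∂Q := by
    rw [← tsum_fintype (L := .unconditional _), ← lintegral_iUnion
      (fun a => A.history_le n _ (A.measurableSet_act_eq n a))
      (pairwise_disjoint_fiber (A.act (n + 1))), A.iUnion_act_eq n,
      Measure.restrict_univ]
  rw [h_split, h_split U]
  refine Finset.sum_le_sum fun a _ => ?_
  rw [hQ.setLIntegral_observed_mul hn a hU (hg a)]
  exact mul_le_of_le_one_right' (hg_le a)

lemma lintegral_prod_observed_le (hQ : FreshAfter A q t Q) {g : Fin K → 𝓧 → ℝ≥0∞}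
    (hg : ∀ a, Measurable (g a)) (hg_le : ∀ a, ∫⁻ x, g a x ∂q a ≤ 1) {s : ℕ} (hs : t < s)
    (n : ℕ) : ∫⁻ ω, ∏ i ∈ Finset.Ico s n, A.observed g i ω ∂Q ≤ Q Set.univ := by
  induction n with
  | zero => simp
  | succ n ih =>
    rcases le_or_gt s n with hsn | hsn
    · refine le_trans ?_ ih
      obtain ⟨n, rfl⟩ : ∃ k, n = k + 1 := ⟨n - 1, by omega⟩
      simp only [Finset.prod_Ico_succ_top hsn]
      refine hQ.lintegral_mul_observed_le (by omega) ?_ hg hg_le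
      refine Finset.measurable_fun_prod _ fun i hi => ?_
      have := Finset.mem_Ico.1 hi
      exact A.measurable_observed hg (by omega) (by omega)
    · simp [Finset.Ico_eq_empty_of_le (Nat.succ_le_of_lt hsn)]

variable [IsFiniteMeasure Q] {f : Fin K → 𝓧 → ℝ}

lemma integrableOn_observed (hQ : FreshAfter A q t Q) {n : ℕ} (hn : t ≤ n) {a : Fin K}
    (hf : Integrable (f a) (q a)) :
    IntegrableOn (A.observed f (n + 1)) (A.act (n + 1) ⁻¹' {a}) Q := by
  have h_act := A.measurableSet_act_eq n a
  have h_map := hQ n hn a _ h_act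
  have h_eval : IntegrableOn (fun ω => f a (ω (n + 1, a))) (A.act (n + 1) ⁻¹' {a}) Q := by
    refine Integrable.comp_measurable (f := fun ω : Observations K 𝓧 => ω (n + 1, a)) (g := f a)
      ?_ (measurable_pi_apply _)
    rw [h_map]
    exact hf.smul_measure (measure_ne_top Q _)
  refine h_eval.congr_fun (fun ω hω => ?_) (A.history_le n _ h_act)
  rw [Set.mem_preimage, Set.mem_singleton_iff] at hω
  simp only [ControlPolicy.observed, hω]

lemma setIntegral_observed (hQ : FreshAfter A q t Q) {n : ℕ} (hn : t ≤ n) {a : Fin K}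
    (hf : Integrable (f a) (q a)) :
    ∫ ω in A.act (n + 1) ⁻¹' {a}, A.observed f (n + 1) ω ∂Q =
      Q.real (A.act (n + 1) ⁻¹' {a}) * ∫ x, f a x ∂q a := by
  have h_act := A.measurableSet_act_eq n a
  have h_map := hQ n hn a _ h_act
  have hX : Measurable fun ω : Observations K 𝓧 => ω (n + 1, a) := measurable_pi_apply _
  calc ∫ ω in A.act (n + 1) ⁻¹' {a}, A.observed f (n + 1) ω ∂Q
      = ∫ ω in A.act (n + 1) ⁻¹' {a}, f a (ω (n + 1, a)) ∂Q := by
        refine setIntegral_congr_fun (A.history_le n _ h_act) fun ω hω => ?_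
        rw [Set.mem_preimage, Set.mem_singleton_iff] at hω
        simp only [ControlPolicy.observed, hω]
    _ = ∫ x, f a x ∂(Q (A.act (n + 1) ⁻¹' {a}) • q a) := by
        rw [← h_map, integral_map hX.aemeasurable]
        rw [h_map]
        exact (hf.smul_measure (measure_ne_top Q _)).aestronglyMeasurable
    _ = Q.real (A.act (n + 1) ⁻¹' {a}) * ∫ x, f a x ∂q a := by
        rw [integral_smul_measure, smul_eq_mul, measureReal_def]

lemma integrable_observed (hQ : FreshAfter A q t Q) (hf : ∀ a, Integrable (f a) (q a)) {n : ℕ}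
    (hn : t ≤ n) : Integrable (A.observed f (n + 1)) Q := by
  rw [← integrableOn_univ, ← A.iUnion_act_eq n]
  exact integrableOn_finite_iUnion.2 fun a => hQ.integrableOn_observed hn (hf a)

lemma integral_observed (hQ : FreshAfter A q t Q) (hf : ∀ a, Integrable (f a) (q a)) {n : ℕ}
    (hn : t ≤ n) :
    ∫ ω, A.observed f (n + 1) ω ∂Q =
      ∑ a, Q.real (A.act (n + 1) ⁻¹' {a}) * ∫ x, f a x ∂q a := by
  rw [← setIntegral_univ, ← A.iUnion_act_eq n,
    integral_iUnion_fintype (fun a => A.history_le n _ (A.measurableSet_act_eq n a))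
      (pairwise_disjoint_fiber _) fun a => hQ.integrableOn_observed hn (hf a)]
  exact Finset.sum_congr rfl fun a _ => hQ.setIntegral_observed hn (hf a)

end FreshAfter

section SubgaussianMGF

variable {Ω : Type*} [MeasurableSpace Ω] {μ : Measure Ω} {X : Ω → ℝ} {v : ℝ≥0}

lemma lintegral_exp_mul_add_le_one_of_hasSubgaussianMGF (hX : HasSubgaussianMGF X v μ) {t s : ℝ}
    (hts : v * t ^ 2 / 2 + s ≤ 0) : ∫⁻ x, ENNReal.ofReal (Real.exp (t * X x + s)) ∂μ ≤ 1 := by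
  simp only [Real.exp_add]
  rw [← ofReal_integral_eq_lintegral_ofReal ((hX.integrable_exp_mul t).mul_const _)
    (.of_forall fun _ => by positivity), integral_mul_const, ENNReal.ofReal_le_one]
  calc mgf X μ t * Real.exp s ≤ Real.exp (v * t ^ 2 / 2) * Real.exp s := by
        gcongr
        exact hX.mgf_le t
    _ = Real.exp (v * t ^ 2 / 2 + s) := (Real.exp_add _ _).symm
    _ ≤ 1 := Real.exp_le_one_iff.2 hts

end SubgaussianMGF

lemma tendsto_integral_min_natCast {Ω : Type*} [MeasurableSpace Ω] {μ : Measure Ω} {f : Ω → ℝ}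
    (hf : Integrable f μ) :
    Tendsto (fun n : ℕ => ∫ x, min (f x) n ∂μ) atTop (𝓝 (∫ x, f x ∂μ)) := by
  refine tendsto_integral_of_dominated_convergence (fun x => |f x|)
    (fun n => hf.aestronglyMeasurable.inf aestronglyMeasurable_const) hf.abs
    (fun n => .of_forall fun x => ?_) (.of_forall fun x => ?_)
  · rcases le_total (f x) n with h | h
    · rw [min_eq_left h, Real.norm_eq_abs]
    · rw [min_eq_right h, Real.norm_natCast]
      exact h.trans (le_abs_self _)
  · refine tendsto_const_nhds.congr' ?_
    filter_upwards [eventually_ge_atTop ⌈f x⌉₊] with n hn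
    exact (min_eq_left (Nat.ceil_le.1 hn)).symm

namespace Channels

variable (M : Channels K 𝓧) {a : Fin K}

lemma measurable_ofReal_exp_llr (a : Fin K) :
    Measurable fun x => ENNReal.ofReal (Real.exp (M.llr a x)) :=
  (M.measurable_llr a).exp.ennreal_ofReal

lemma kl_eq_integral (a : Fin K) : M.kl a = ∫ x, M.llr a x ∂M.postMeasure a := by
  rw [postMeasure, integral_withDensity_eq_integral_toReal_smul
    (M.measurable_post a).ennreal_ofReal (.of_forall fun _ => ENNReal.ofReal_lt_top), kl]
  refine integral_congr_ae (.of_forall fun x => ?_)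
  simp only [ENNReal.toReal_ofReal (M.post_nonneg a x), llr, smul_eq_mul, mul_comm]

section LikelihoodRatio

variable (hsupp : ∀ᵐ x ∂M.base, M.pre a x = 0 ↔ M.post a x = 0)
include hsupp

lemma postMeasure_eq_withDensity :
    M.postMeasure a =
      (M.preMeasure a).withDensity fun x => ENNReal.ofReal (Real.exp (M.llr a x)) := by
  rw [preMeasure, ← withDensity_mul _ (M.measurable_pre a).ennreal_ofReal
    (M.measurable_ofReal_exp_llr a)]
  refine withDensity_congr_ae ?_
  filter_upwards [hsupp] with x hx
  rw [Pi.mul_apply, ← ENNReal.ofReal_mul (M.pre_nonneg a x)]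
  by_cases hpre : M.pre a x = 0
  · rw [hx.1 hpre, hpre, zero_mul]
  · have hpre_pos : 0 < M.pre a x := (M.pre_nonneg a x).lt_of_ne' hpre
    have hpost_pos : 0 < M.post a x := (M.post_nonneg a x).lt_of_ne' (mt hx.2 hpre)
    rw [llr, Real.exp_log (div_pos hpost_pos hpre_pos), mul_div_cancel₀ _ hpre]

lemma lintegral_exp_llr_preMeasure :
    ∫⁻ x, ENNReal.ofReal (Real.exp (M.llr a x)) ∂M.preMeasure a = 1 := by
  rw [← setLIntegral_univ, ← withDensity_apply _ .univ, ← M.postMeasure_eq_withDensity hsupp,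
    measure_univ]

lemma mgf_llr_postMeasure (t : ℝ) :
    mgf (M.llr a) (M.postMeasure a) t = mgf (M.llr a) (M.preMeasure a) (t + 1) := by
  rw [mgf, M.postMeasure_eq_withDensity hsupp, integral_withDensity_eq_integral_toReal_smul
    (M.measurable_ofReal_exp_llr a) (.of_forall fun _ => ENNReal.ofReal_lt_top), mgf]
  refine integral_congr_ae (.of_forall fun x => ?_)
  simp only [ENNReal.toReal_ofReal (Real.exp_nonneg _), smul_eq_mul, ← Real.exp_add]
  ring_nf

lemma integrable_exp_mul_llr_preMeasure {t : ℝ}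
    (h : Integrable (fun x => Real.exp (t * M.llr a x)) (M.postMeasure a)) :
    Integrable (fun x => Real.exp ((t + 1) * M.llr a x)) (M.preMeasure a) := by
  rw [M.postMeasure_eq_withDensity hsupp, integrable_withDensity_iff
    (M.measurable_ofReal_exp_llr a) (.of_forall fun _ => ENNReal.ofReal_lt_top)] at h
  refine h.congr (.of_forall fun x => ?_)
  simp only [ENNReal.toReal_ofReal (Real.exp_nonneg _), ← Real.exp_add]
  ring_nf

end LikelihoodRatio

section Subgaussian

variable {v : ℝ≥0}
  (hsub : HasSubgaussianMGF (fun x => M.llr a x - M.kl a) v (M.postMeasure a))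
include hsub

lemma integrable_exp_mul_llr_postMeasure (t : ℝ) :
    Integrable (fun x => Real.exp (t * M.llr a x)) (M.postMeasure a) := by
  refine ((hsub.integrable_exp_mul t).mul_const (Real.exp (t * M.kl a))).congr
    (.of_forall fun x => ?_)
  simp only [← Real.exp_add]
  ring_nf

lemma integrable_llr_postMeasure : Integrable (M.llr a) (M.postMeasure a) :=
  (hsub.integrable.add (integrable_const (M.kl a))).congr (.of_forall fun x => by simp)

lemma integrable_llr_preMeasure (hsupp : ∀ᵐ x ∂M.base, M.pre a x = 0 ↔ M.post a x = 0) :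
    Integrable (M.llr a) (M.preMeasure a) := by
  have h_exp (t : ℝ) : Integrable (fun x => Real.exp (t * M.llr a x)) (M.preMeasure a) := by
    simpa using M.integrable_exp_mul_llr_preMeasure hsupp
      (M.integrable_exp_mul_llr_postMeasure hsub (t - 1))
  simpa using integrable_pow_of_integrable_exp_mul one_ne_zero (h_exp 1) (h_exp (-1)) 1

lemma kl_le_half (hsupp : ∀ᵐ x ∂M.base, M.pre a x = 0 ↔ M.post a x = 0) : M.kl a ≤ v / 2 := by
  have h_mgf : mgf (M.llr a) (M.postMeasure a) (-1) = 1 := by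
    rw [M.mgf_llr_postMeasure hsupp, neg_add_cancel, mgf_zero]
  have h_le := hsub.mgf_le (-1)
  simp only [sub_eq_add_neg] at h_le
  rw [mgf_add_const, h_mgf, one_mul, Real.exp_le_exp] at h_le
  linarith

end Subgaussian

/-- The law of the observations of stream `a` once the streams in `𝒜` have changed. -/
def changedMeasure (𝒜 : Finset (Fin K)) (a : Fin K) : Measure 𝓧 :=
  if a ∈ 𝒜 then M.postMeasure a else M.preMeasure a

instance (𝒜 : Finset (Fin K)) (a : Fin K) : IsProbabilityMeasure (M.changedMeasure 𝒜 a) := by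
  unfold changedMeasure
  split_ifs <;> infer_instance

lemma changedMeasure_of_mem {𝒜 : Finset (Fin K)} (ha : a ∈ 𝒜) :
    M.changedMeasure 𝒜 a = M.postMeasure a :=
  if_pos ha

lemma freshAfter_lawNoChange (A : ControlPolicy K 𝓧) :
    FreshAfter A M.preMeasure 0 M.lawNoChange :=
  freshAfter_infinitePi A _ fun _ _ _ => rfl

lemma freshAfter_law (A : ControlPolicy K 𝓧) (𝒜 : Finset (Fin K)) (ν : ℕ) :
    FreshAfter A (M.changedMeasure 𝒜) (ν - 1) (M.law 𝒜 ν) := by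
  have (p : ℕ × Fin K) : IsProbabilityMeasure
      (if ν ≤ p.1 ∧ p.2 ∈ 𝒜 then M.postMeasure p.2 else M.preMeasure p.2) := by
    split_ifs <;> infer_instance
  refine freshAfter_infinitePi A _ fun n hn a => ?_
  simp only [show ν ≤ n by omega, true_and, changedMeasure]

section Subgaussian

variable {v : ℝ≥0} (𝒜 : Finset (Fin K))

lemma integrable_llr_changedMeasure
    (hsub : HasSubgaussianMGF (fun x => M.llr a x - M.kl a) v (M.postMeasure a))
    (hsupp : ∀ᵐ x ∂M.base, M.pre a x = 0 ↔ M.post a x = 0) :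
    Integrable (M.llr a) (M.changedMeasure 𝒜 a) := by
  unfold changedMeasure
  split_ifs
  exacts [M.integrable_llr_postMeasure hsub, M.integrable_llr_preMeasure hsub hsupp]

lemma exists_le_integral_min_llr
    (hsub : ∀ a, HasSubgaussianMGF (fun x => M.llr a x - M.kl a) v (M.postMeasure a))
    {ε : ℝ} (hε : 0 < ε) :
    ∃ B : ℝ, 0 ≤ B ∧ ∀ a, M.kl a - ε ≤ ∫ x, min (M.llr a x) B ∂M.postMeasure a := by
  have h_lim (a : Fin K) : Tendsto (fun n : ℕ => ∫ x, min (M.llr a x) n ∂M.postMeasure a) atTop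
      (𝓝 (M.kl a)) :=
    M.kl_eq_integral a ▸ tendsto_integral_min_natCast (M.integrable_llr_postMeasure (hsub a))
  obtain ⟨n, hn⟩ := (eventually_all.2 fun a =>
    (h_lim a).eventually_const_le (sub_lt_self (M.kl a) hε)).exists
  exact ⟨n, n.cast_nonneg, hn⟩

-- Unaffected streams have negative drift, so `exp llr` itself serves; the others use the
-- subgaussian bound at the midpoint between their divergence and `I`.
lemma exists_lintegral_exp_llr_changedMeasure_le_one {I : ℝ} (hI : 0 < I) (hv : 0 < v)
    (hsupp : ∀ᵐ x ∂M.base, M.pre a x = 0 ↔ M.post a x = 0)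
    (hsub : HasSubgaussianMGF (fun x => M.llr a x - M.kl a) v (M.postMeasure a))
    (ha : a ∈ 𝒜 → M.kl a < I) :
    ∃ δ > 0, ∃ c > 0, ∃ θ > 0, ∫⁻ x, ENNReal.ofReal (Real.exp (θ * (M.llr a x - (I - δ)) + c))
      ∂M.changedMeasure 𝒜 a ≤ 1 := by
  by_cases hmem : a ∈ 𝒜
  · obtain ⟨δ, hδ, hIδ⟩ : ∃ δ > 0, I - δ = M.kl a + δ :=
      ⟨(I - M.kl a) / 2, by linarith [ha hmem], by ring⟩
    refine ⟨δ, hδ, δ ^ 2 / (2 * v), by positivity, δ / v, by positivity, ?_⟩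
    rw [M.changedMeasure_of_mem hmem, hIδ]
    have h_exp (x : 𝓧) : δ / v * (M.llr a x - (M.kl a + δ)) + δ ^ 2 / (2 * v) =
        δ / v * (M.llr a x - M.kl a) + (-(δ / v) * δ + δ ^ 2 / (2 * v)) := by ring
    simp only [h_exp]
    refine lintegral_exp_mul_add_le_one_of_hasSubgaussianMGF hsub (le_of_eq ?_)
    field_simp
    ring
  · refine ⟨I / 2, by positivity, I / 2, by positivity, 1, one_pos, ?_⟩
    rw [changedMeasure, if_neg hmem, ← M.lintegral_exp_llr_preMeasure hsupp]
    refine (lintegral_congr fun x => ?_).le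
    ring_nf

end Subgaussian

end Channels

section StoppingTime

variable {Ω : Type*} {T : Ω → ℕ∞} {b : ℝ}

lemma tsum_indicator_lt (T : Ω → ℕ∞) (ω : Ω) :
    ∑' n : ℕ, {ω | (n : ℕ∞) < T ω}.indicator (1 : Ω → ℝ≥0∞) ω = T ω := by
  classical
  simp only [Set.indicator_apply, Set.mem_ofPred_eq, Pi.one_apply]
  cases T ω with
  | top => simp [ENNReal.tsum_const_eq_top_of_ne_zero one_ne_zero]
  | coe m =>
    rw [tsum_eq_sum (s := Finset.range m) fun n hn => by simpa using hn]
    simp [Finset.sum_ite_of_true fun _ hn => Finset.mem_range.1 hn]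

lemma tsum_measure_lt_eq_lintegral [MeasurableSpace Ω] {P : Measure Ω}
    (hT : ∀ n : ℕ, MeasurableSet {ω | (n : ℕ∞) < T ω}) :
    ∑' n : ℕ, P {ω | (n : ℕ∞) < T ω} = ∫⁻ ω, (T ω : ℝ≥0∞) ∂P := by
  simp only [← tsum_indicator_lt T]
  rw [lintegral_tsum fun n => (measurable_one.indicator (hT n)).aemeasurable]
  exact tsum_congr fun n => (lintegral_indicator_one (hT n)).symm

lemma lt_hittingAfter_Ici_iff {u : ℕ → Ω → ℝ} {m n : ℕ} {ω : Ω} :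
    (n : ℕ∞) < hittingAfter u (Set.Ici b) m ω ↔ ∀ i ∈ Finset.Icc m n, u i ω < b :=
  not_le.symm.trans (hittingAfter_le_iff.not.trans (by simp [and_assoc]))

lemma le_of_hittingAfter_Ici_eq {u : ℕ → Ω → ℝ} {m n : ℕ} {ω : Ω}
    (h : hittingAfter u (Set.Ici b) m ω = n) : b ≤ u n ω := by
  have h_mem := hittingAfter_mem_set_of_ne_top (u := u) (s := Set.Ici b) (n := m) (ω := ω)
    (h ▸ WithTop.coe_ne_top)
  rw [h] at h_mem
  exact h_mem

lemma measurableSet_lt_hittingAfter_Ici [MeasurableSpace Ω] {u : ℕ → Ω → ℝ} {m n : ℕ}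
    (hu : ∀ i ≤ n, Measurable (u i)) :
    MeasurableSet {ω | (n : ℕ∞) < hittingAfter u (Set.Ici b) m ω} := by
  simp only [lt_hittingAfter_Ici_iff, Set.ofPred_forall]
  exact Finset.measurableSet_biInter _ fun i hi =>
    measurableSet_lt (hu i (Finset.mem_Icc.1 hi).2) measurable_const

end StoppingTime

section OptionalStopping

variable {Ω : Type*} [MeasurableSpace Ω] {P : Measure Ω} {T : Ω → ℕ∞} {R : ℕ → Ω → ℝ≥0∞}
  {γ : ℝ≥0∞}

lemma setLIntegral_add_mul_measure_compl_le
    (hT : ∀ n : ℕ, MeasurableSet {ω | (n : ℕ∞) < T ω}) (hT_pos : ∀ ω, 0 < T ω) (hR_zero : R 0 = 0)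
    (hR_drift : ∀ n : ℕ, ∫⁻ ω in {ω | (n : ℕ∞) < T ω}, R (n + 1) ω ∂P ≤
      P {ω | (n : ℕ∞) < T ω} + ∫⁻ ω in {ω | (n : ℕ∞) < T ω}, R n ω ∂P)
    (hR_stop : ∀ (n : ℕ) ω, T ω = (n + 1 : ℕ) → γ ≤ R (n + 1) ω) (n : ℕ) :
    ∫⁻ ω in {ω | (n : ℕ∞) < T ω}, R n ω ∂P + γ * P {ω | (n : ℕ∞) < T ω}ᶜ ≤
      ∑ k ∈ Finset.range n, P {ω | (k : ℕ∞) < T ω} := by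
  set D : ℕ → Set Ω := fun n => {ω | (n : ℕ∞) < T ω}
  induction n with
  | zero =>
    have h_univ : D 0 = Set.univ := Set.eq_univ_of_forall fun ω => by simpa [D] using hT_pos ω
    change ∫⁻ ω in D 0, R 0 ω ∂P + γ * P (D 0)ᶜ ≤ _
    simp [h_univ, hR_zero]
  | succ n ih =>
    have h_anti : D (n + 1) ⊆ D n := fun ω hω =>
      (show (n : ℕ∞) < (n + 1 : ℕ) from mod_cast n.lt_succ_self).trans hω
    have h_stop : γ * P (D n \ D (n + 1)) ≤ ∫⁻ ω in D n \ D (n + 1), R (n + 1) ω ∂P := by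
      rw [← setLIntegral_const]
      refine setLIntegral_mono' ((hT n).diff (hT (n + 1))) fun ω hω => hR_stop n ω ?_
      refine le_antisymm (not_lt.1 hω.2) ?_
      rw [Nat.cast_add_one]
      exact Order.add_one_le_of_lt hω.1
    have h_split : ∫⁻ ω in D (n + 1), R (n + 1) ω ∂P + ∫⁻ ω in D n \ D (n + 1), R (n + 1) ω ∂P =
        ∫⁻ ω in D n, R (n + 1) ω ∂P := by
      rw [← lintegral_inter_add_sdiff (R (n + 1)) (D n) (hT (n + 1)),
        Set.inter_eq_self_of_subset_right h_anti]
    have h_compl : P (D (n + 1))ᶜ ≤ P (D n \ D (n + 1)) + P (D n)ᶜ := by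
      refine (measure_mono fun ω hω => ?_).trans (measure_union_le _ _)
      exact (em (ω ∈ D n)).imp (fun h => ⟨h, hω⟩) id
    calc ∫⁻ ω in D (n + 1), R (n + 1) ω ∂P + γ * P (D (n + 1))ᶜ
        ≤ ∫⁻ ω in D (n + 1), R (n + 1) ω ∂P + γ * (P (D n \ D (n + 1)) + P (D n)ᶜ) := by gcongr
      _ ≤ ∫⁻ ω in D n, R (n + 1) ω ∂P + γ * P (D n)ᶜ := by
          rw [mul_add, ← add_assoc, ← h_split]
          gcongr
      _ ≤ P (D n) + (∫⁻ ω in D n, R n ω ∂P + γ * P (D n)ᶜ) := by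
          rw [← add_assoc]
          gcongr
          exact hR_drift n
      _ ≤ ∑ k ∈ Finset.range (n + 1), P (D k) := by
          rw [Finset.sum_range_succ, add_comm (P (D n))]
          gcongr

lemma le_lintegral_of_unit_drift [IsProbabilityMeasure P] (hγ : γ ≠ ∞)
    (hT : ∀ n : ℕ, MeasurableSet {ω | (n : ℕ∞) < T ω}) (hT_pos : ∀ ω, 0 < T ω) (hR_zero : R 0 = 0)
    (hR_drift : ∀ n : ℕ, ∫⁻ ω in {ω | (n : ℕ∞) < T ω}, R (n + 1) ω ∂P ≤
      P {ω | (n : ℕ∞) < T ω} + ∫⁻ ω in {ω | (n : ℕ∞) < T ω}, R n ω ∂P)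
    (hR_stop : ∀ (n : ℕ) ω, T ω = (n + 1 : ℕ) → γ ≤ R (n + 1) ω) :
    γ ≤ ∫⁻ ω, (T ω : ℝ≥0∞) ∂P := by
  rw [← tsum_measure_lt_eq_lintegral hT]
  by_cases h_top : ∑' n : ℕ, P {ω | (n : ℕ∞) < T ω} = ∞
  · exact h_top ▸ le_top
  have h_lim : Tendsto (fun n : ℕ => γ * P {ω | (n : ℕ∞) < T ω} +
      ∑' n : ℕ, P {ω | (n : ℕ∞) < T ω}) atTop (𝓝 (∑' n : ℕ, P {ω | (n : ℕ∞) < T ω})) := by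
    simpa using (ENNReal.Tendsto.const_mul
      (ENNReal.tendsto_atTop_zero_of_tsum_ne_top h_top) (.inr hγ)).add_const _
  refine ge_of_tendsto' h_lim fun n => ?_
  calc γ = γ * P {ω | (n : ℕ∞) < T ω} + γ * P {ω | (n : ℕ∞) < T ω}ᶜ := by
        rw [← mul_add, measure_add_measure_compl (hT n), measure_univ, mul_one]
    _ ≤ γ * P {ω | (n : ℕ∞) < T ω} + ∑' n : ℕ, P {ω | (n : ℕ∞) < T ω} := by
        gcongr
        exact (le_add_self.trans (setLIntegral_add_mul_measure_compl_le hT hT_pos hR_zero hR_drift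
          hR_stop n)).trans (ENNReal.sum_le_tsum _)

end OptionalStopping

section Wald

variable {Ω : Type*} {Y : ℕ → Ω → ℝ} {b β μ : ℝ}

/-- The first time at which the partial sums of `Y` reach the level `b`. -/
def sumHittingTime (Y : ℕ → Ω → ℝ) (b : ℝ) : Ω → ℕ∞ :=
  hittingAfter (fun n ω => ∑ i ∈ Finset.range n, Y i ω) (Set.Ici b) 0

lemma measurableSet_lt_sumHittingTime [MeasurableSpace Ω] {n : ℕ}
    (hY : ∀ i < n, Measurable (Y i)) : MeasurableSet {ω | (n : ℕ∞) < sumHittingTime Y b ω} :=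
  measurableSet_lt_hittingAfter_Ici fun _ hi =>
    Finset.measurable_fun_sum _ fun j hj => hY j ((Finset.mem_range.1 hj).trans_le hi)

lemma sum_indicator_lt_sumHittingTime_le (hbβ : 0 ≤ b + β) {ω : Ω} (hY : ∀ k, Y k ω ≤ β)
    (N : ℕ) :
    ∑ k ∈ Finset.range N, {ω | (k : ℕ∞) < sumHittingTime Y b ω}.indicator (Y k) ω ≤ b + β := by
  suffices h : ∑ k ∈ Finset.range N, {ω | (k : ℕ∞) < sumHittingTime Y b ω}.indicator (Y k) ω
      ≤ b + β ∧ ((N : ℕ∞) < sumHittingTime Y b ω →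
        ∑ k ∈ Finset.range N, {ω | (k : ℕ∞) < sumHittingTime Y b ω}.indicator (Y k) ω =
          ∑ k ∈ Finset.range N, Y k ω) from h.1
  induction N with
  | zero => simpa using hbβ
  | succ N ih =>
    rw [Finset.sum_range_succ, Finset.sum_range_succ]
    by_cases hN : (N : ℕ∞) < sumHittingTime Y b ω
    · rw [Set.indicator_of_mem (by exact hN), ih.2 hN]
      have h_lt := lt_hittingAfter_Ici_iff.1 hN N (Finset.mem_Icc.2 ⟨N.zero_le, le_rfl⟩)
      exact ⟨add_le_add h_lt.le (hY N), fun _ => rfl⟩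
    · rw [Set.indicator_of_notMem (by exact hN), add_zero]
      refine ⟨ih.1, fun h => absurd (lt_trans ?_ h) hN⟩
      exact mod_cast N.lt_succ_self

lemma lintegral_sumHittingTime_le [MeasurableSpace Ω] {Q : Measure Ω} [IsFiniteMeasure Q]
    (hμ : 0 < μ) (hbβ : 0 ≤ b + β) (hYβ : ∀ k ω, Y k ω ≤ β) (hY_meas : ∀ k, Measurable (Y k))
    (hY_int : ∀ k, Integrable (Y k) Q)
    (hY_drift : ∀ k : ℕ, μ * Q.real {ω | (k : ℕ∞) < sumHittingTime Y b ω} ≤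
      ∫ ω in {ω | (k : ℕ∞) < sumHittingTime Y b ω}, Y k ω ∂Q) :
    ∫⁻ ω, (sumHittingTime Y b ω : ℝ≥0∞) ∂Q ≤ ENNReal.ofReal ((b + β) / μ) * Q Set.univ := by
  set D : ℕ → Set Ω := fun k => {ω | (k : ℕ∞) < sumHittingTime Y b ω}
  have hD (k : ℕ) : MeasurableSet (D k) := measurableSet_lt_sumHittingTime fun i _ => hY_meas i
  rw [← tsum_measure_lt_eq_lintegral hD, ← ofReal_measureReal,
    ← ENNReal.ofReal_mul (by positivity)]
  refine ENNReal.tsum_le_of_sum_range_le fun N => ?_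
  rw [← ENNReal.ofReal_toReal (ENNReal.sum_ne_top.2 fun k _ => measure_ne_top Q (D k)),
    ENNReal.toReal_sum fun k _ => measure_ne_top Q (D k)]
  refine ENNReal.ofReal_le_ofReal ?_
  rw [div_mul_eq_mul_div, le_div_iff₀' hμ, Finset.mul_sum]
  calc ∑ k ∈ Finset.range N, μ * Q.real (D k)
      ≤ ∑ k ∈ Finset.range N, ∫ ω, (D k).indicator (Y k) ω ∂Q :=
        Finset.sum_le_sum fun k _ => (hY_drift k).trans_eq (integral_indicator (hD k)).symm
    _ = ∫ ω, ∑ k ∈ Finset.range N, (D k).indicator (Y k) ω ∂Q :=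
        (integral_finsetSum _ fun k _ => (hY_int k).indicator (hD k)).symm
    _ ≤ ∫ _, (b + β) ∂Q :=
        integral_mono (integrable_finsetSum _ fun k _ => (hY_int k).indicator (hD k))
          (integrable_const _) fun ω => sum_indicator_lt_sumHittingTime_le hbβ (hYβ · ω) N
    _ = (b + β) * Q.real Set.univ := by rw [integral_const, smul_eq_mul, mul_comm]

end Wald

/-- The Shiryaev-Roberts statistic `R_0 = 0`, `R_n = (1 + R_{n-1}) exp LLR(A_n, X_{A_n,n})`; before
a change `R_n - n` is a martingale. -/
def shiryaevRoberts (M : Channels K 𝓧) (A : ControlPolicy K 𝓧) : ℕ → Observations K 𝓧 → ℝ≥0∞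
  | 0, _ => 0
  | n + 1, ω => (1 + shiryaevRoberts M A n ω) *
      A.observed (fun a x => ENNReal.ofReal (Real.exp (M.llr a x))) (n + 1) ω

section FalseAlarm

variable (M : Channels K 𝓧) (A : ControlPolicy K 𝓧)

lemma measurable_cusum {i n : ℕ} (hin : i ≤ n) : Measurable[history A.act n] (cusum M A i) := by
  induction i with
  | zero => exact measurable_const
  | succ i ih =>
    exact ((ih (by omega)).max measurable_const).add
      (A.measurable_observed M.measurable_llr (by omega) hin)

lemma measurable_shiryaevRoberts {i n : ℕ} (hin : i ≤ n) :
    Measurable[history A.act n] (shiryaevRoberts M A i) := by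
  induction i with
  | zero => exact measurable_const
  | succ i ih =>
    exact (measurable_const.add (ih (by omega))).mul
      (A.measurable_observed M.measurable_ofReal_exp_llr (by omega) hin)

lemma exp_cusum_succ_le_shiryaevRoberts (n : ℕ) (ω : Observations K 𝓧) :
    ENNReal.ofReal (Real.exp (cusum M A (n + 1) ω)) ≤ shiryaevRoberts M A (n + 1) ω := by
  have h_max : ENNReal.ofReal (Real.exp (max (cusum M A n ω) 0)) ≤
      1 + shiryaevRoberts M A n ω := by
    rw [Real.exp_monotone.map_max, ENNReal.ofReal_max, Real.exp_zero, ENNReal.ofReal_one]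
    refine max_le ?_ le_self_add
    cases n with
    | zero => simp [cusum]
    | succ n => exact (exp_cusum_succ_le_shiryaevRoberts n ω).trans le_add_self
  rw [cusum, shiryaevRoberts, Real.exp_add, ENNReal.ofReal_mul (Real.exp_nonneg _)]
  exact mul_le_mul_left h_max _

lemma measurableSet_lt_alarmTime (b : ℝ) (n : ℕ) :
    MeasurableSet[history A.act n] {ω | (n : ℕ∞) < alarmTime M A b ω} :=
  @measurableSet_lt_hittingAfter_Ici _ _ (history A.act n) _ _ _ fun _ hi =>
    measurable_cusum M A hi

lemma setLIntegral_shiryaevRoberts_succ_le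
    (hsupp : ∀ a, ∀ᵐ x ∂M.base, M.pre a x = 0 ↔ M.post a x = 0) {n : ℕ}
    {D : Set (Observations K 𝓧)} (hD : MeasurableSet[history A.act n] D) :
    ∫⁻ ω in D, shiryaevRoberts M A (n + 1) ω ∂M.lawNoChange ≤
      M.lawNoChange D + ∫⁻ ω in D, shiryaevRoberts M A n ω ∂M.lawNoChange := by
  have h_fresh := ((M.freshAfter_lawNoChange A).mono n.zero_le).restrict hD
  calc ∫⁻ ω in D, shiryaevRoberts M A (n + 1) ω ∂M.lawNoChange
      ≤ ∫⁻ ω in D, (1 + shiryaevRoberts M A n ω) ∂M.lawNoChange :=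
        h_fresh.lintegral_mul_observed_le le_rfl
          (measurable_const.add (measurable_shiryaevRoberts M A le_rfl))
          M.measurable_ofReal_exp_llr fun a => (M.lintegral_exp_llr_preMeasure (hsupp a)).le
    _ = M.lawNoChange D + ∫⁻ ω in D, shiryaevRoberts M A n ω ∂M.lawNoChange := by
        rw [lintegral_add_left measurable_const, setLIntegral_one]

lemma ofReal_exp_le_meanTimeToFalseAlarm
    (hsupp : ∀ a, ∀ᵐ x ∂M.base, M.pre a x = 0 ↔ M.post a x = 0) (b : ℝ) :
    ENNReal.ofReal (Real.exp b) ≤ meanTimeToFalseAlarm M (alarmTime M A b) := by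
  refine le_lintegral_of_unit_drift (R := shiryaevRoberts M A) ENNReal.ofReal_ne_top
    (fun n => A.history_le n _ (measurableSet_lt_alarmTime M A b n)) (fun ω => ?_) rfl
    (fun n => setLIntegral_shiryaevRoberts_succ_le M A hsupp (measurableSet_lt_alarmTime M A b n))
    fun n ω hω => ?_
  · exact lt_of_lt_of_le one_pos (le_hittingAfter (u := cusum M A) ω)
  · exact (ENNReal.ofReal_le_ofReal (Real.exp_le_exp.2 (le_of_hittingAfter_Ici_eq hω))).trans
      (exp_cusum_succ_le_shiryaevRoberts M A n ω)

end FalseAlarm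

lemma essSup_condLExp_le {Ω : Type*} {m mΩ : MeasurableSpace Ω} {P : Measure Ω}
    [IsFiniteMeasure P] (hm : m ≤ mΩ) {X : Ω → ℝ≥0∞} {c : ℝ≥0∞}
    (h : ∀ G, MeasurableSet[m] G → ∫⁻ ω in G, X ω ∂P ≤ c * P G) :
    essSup (condLExp m P X) P ≤ c := by
  refine essSup_le_of_ae_le c (ae_le_of_ae_le_trim (hm := hm) ?_)
  refine ae_le_of_forall_setLIntegral_le_of_sigmaFinite (measurable_condLExp m P X)
    fun s hs _ => ?_
  rw [setLIntegral_condLExp_trim hm P X hs, setLIntegral_const, trim_measurableSet_eq hm hs]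
  exact h s hs

lemma sum_measure_le_natCast_mul {Ω ι : Type*} [MeasurableSpace Ω] {Q : Measure Ω}
    {s : Finset ι} {E : ι → Set Ω} [∀ i, DecidablePred (· ∈ E i)] {u : ℕ}
    (hE : ∀ i ∈ s, MeasurableSet (E i)) (hu : ∀ ω, (s.filter (ω ∈ E ·)).card ≤ u) :
    ∑ i ∈ s, Q (E i) ≤ u * Q Set.univ := by
  calc ∑ i ∈ s, Q (E i) = ∑ i ∈ s, ∫⁻ ω, (E i).indicator 1 ω ∂Q :=
        Finset.sum_congr rfl fun i hi => (lintegral_indicator_one (hE i hi)).symm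
    _ = ∫⁻ ω, ∑ i ∈ s, (E i).indicator 1 ω ∂Q :=
        (lintegral_finsetSum' _ fun i hi => (measurable_one.indicator (hE i hi)).aemeasurable).symm
    _ ≤ ∫⁻ _, (u : ℝ≥0∞) ∂Q := by
        refine lintegral_mono fun ω => ?_
        simpa [Set.indicator_apply] using hu ω
    _ = u * Q Set.univ := lintegral_const _

lemma card_filter_and_card_filter_lt_le (p : ℕ → Prop) [DecidablePred p] (s n u : ℕ) :
    ((Finset.Ico s n).filter fun i => p i ∧ ((Finset.Ico s i).filter p).card < u).card ≤ u := by
  suffices h : ((Finset.Ico s n).filter fun i => p i ∧ ((Finset.Ico s i).filter p).card < u).card ≤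
      min u ((Finset.Ico s n).filter p).card from h.trans (min_le_left _ _)
  induction n with
  | zero => simp
  | succ n ih =>
    rcases le_or_gt s n with hsn | hsn
    · rw [← Finset.insert_Ico_right_eq_Ico_add_one hsn, Finset.filter_insert, Finset.filter_insert]
      grind
    · simp [Finset.Ico_eq_empty_of_le (Nat.succ_le_of_lt hsn)]

lemma sub_mul_sum_le_sum_mul {ι : Type*} [Fintype ι] {w d : ι → ℝ} {J η : ℝ}
    (hw : ∀ a, 0 ≤ w a) (hη : 0 ≤ η) (h : ∀ a, J ≤ d a ∨ w a ≤ η * ∑ b, w b) :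
    (J - η * ∑ a, |d a - J|) * ∑ a, w a ≤ ∑ a, w a * d a := by
  have hS : 0 ≤ ∑ b, w b := Finset.sum_nonneg fun a _ => hw a
  have h_term (a : ι) : -(η * |d a - J| * ∑ b, w b) ≤ w a * (d a - J) := by
    rcases h a with hd | hwa
    · exact (neg_nonpos.2 (by positivity)).trans (mul_nonneg (hw a) (sub_nonneg.2 hd))
    · calc -(η * |d a - J| * ∑ b, w b) = (η * ∑ b, w b) * -|d a - J| := by ring
        _ ≤ w a * -|d a - J| :=
          mul_le_mul_of_nonpos_right hwa (neg_nonpos.2 (abs_nonneg _))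
        _ ≤ w a * (d a - J) := mul_le_mul_of_nonneg_left (neg_abs_le _) (hw a)
  calc (J - η * ∑ a, |d a - J|) * ∑ a, w a
      = J * ∑ a, w a + ∑ a, -(η * |d a - J| * ∑ b, w b) := by
        rw [Finset.sum_neg_distrib, ← Finset.sum_mul, ← Finset.mul_sum]
        ring
    _ ≤ J * ∑ a, w a + ∑ a, w a * (d a - J) := by
        gcongr with a
        exact h_term a
    _ = ∑ a, w a * d a := by
        simp only [mul_sub, Finset.sum_sub_distrib, ← Finset.sum_mul]
        ring

lemma eventually_log_le_mul {C ε : ℝ} (hε : 0 < ε) :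
    ∀ᶠ W : ℕ in atTop, C * Real.log W ≤ ε * W := by
  have h_littleO := (Real.isLittleO_log_id_atTop.const_mul_left C).comp_tendsto
    tendsto_natCast_atTop_atTop
  filter_upwards [h_littleO.bound hε] with W hW
  simpa using (le_abs_self _).trans hW

lemma eventually_exists_log_le_mul_and_add_exp_le {C D c ε : ℝ} (hD : 0 < D) (hc : 0 < c)
    (hε : 0 < ε) :
    ∀ᶠ W : ℕ in atTop, ∃ u : ℕ, 0 < u ∧ C * Real.log W ≤ D * u ∧
      u + W * Real.exp (-(c * u)) + 1 ≤ ε * W := by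
  have h_cast : Tendsto (fun W : ℕ => ε / 4 * W) atTop atTop :=
    tendsto_natCast_atTop_atTop.const_mul_atTop (by positivity)
  have h_exp := (Real.tendsto_exp_neg_atTop_nhds_zero.comp
    (h_cast.const_mul_atTop hc)).eventually_le_const (show 0 < ε / 4 by positivity)
  filter_upwards [h_exp, eventually_log_le_mul (C := C) (show 0 < D * (ε / 4) by positivity),
    h_cast.eventually_ge_atTop 1] with W hW_exp hW_log hW_one
  have h_le : ε / 4 * W ≤ ⌈ε / 4 * W⌉₊ := Nat.le_ceil _
  have h_ge : (⌈ε / 4 * W⌉₊ : ℝ) ≤ ε / 4 * W + 1 := (Nat.ceil_lt_add_one (by positivity)).le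
  refine ⟨⌈ε / 4 * W⌉₊, Nat.ceil_pos.2 (by linarith), hW_log.trans ?_, ?_⟩
  · rw [mul_assoc]
    gcongr
  · have h_mul : W * Real.exp (-(c * ⌈ε / 4 * W⌉₊)) ≤ W * (ε / 4) := by
      refine mul_le_mul_of_nonneg_left (le_trans ?_ hW_exp) W.cast_nonneg
      exact Real.exp_le_exp.2 (neg_le_neg (mul_le_mul_of_nonneg_left h_le hc.le))
    linarith

lemma exists_tendsto_zero_le_ofReal {ι : Type*} {l : Filter ι} {d : ι → ℝ≥0∞} {x : ι → ℝ}
    (hx : ∀ᶠ i in l, 0 < x i)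
    (h : ∀ ε : ℝ, 0 < ε → ∀ᶠ i in l, d i ≤ ENNReal.ofReal (x i * (1 + ε))) :
    ∃ r : ι → ℝ, Tendsto r l (𝓝 0) ∧ ∀ᶠ i in l, d i ≤ ENNReal.ofReal (x i * (1 + r i)) := by
  refine ⟨fun i => max 0 ((d i).toReal / x i - 1), ?_, ?_⟩
  · refine tendsto_order.2 ⟨fun c hc => .of_forall fun i => lt_max_of_lt_left hc, fun c hc => ?_⟩
    filter_upwards [hx, h (c / 2) (by positivity)] with i hxi hi
    have h_le := ENNReal.toReal_le_of_le_ofReal (by positivity) hi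
    have h_div : (d i).toReal / x i ≤ 1 + c / 2 := (div_le_iff₀' hxi).2 h_le
    exact max_lt hc (by linarith)
  · filter_upwards [hx, h 1 one_pos] with i hxi hi
    have hd : d i ≠ ∞ := ne_top_of_le_ne_top ENNReal.ofReal_ne_top hi
    refine (ENNReal.le_ofReal_iff_toReal_le hd (by positivity)).2 ?_
    rw [← div_le_iff₀' hxi, ← sub_le_iff_le_add']
    exact le_max_right _ _

section Concentration

variable {A : ControlPolicy K 𝓧} {q : Fin K → Measure 𝓧} {t : ℕ} {Q : Measure (Observations K 𝓧)}

lemma FreshAfter.measure_le_sum_observed_le (hQ : FreshAfter A q t Q) {f : Fin K → 𝓧 → ℝ}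
    (hf : ∀ a, Measurable (f a))
    (hf_le : ∀ a, ∫⁻ x, ENNReal.ofReal (Real.exp (f a x)) ∂q a ≤ 1) {s : ℕ} (hs : t < s) (n : ℕ)
    (y : ℝ) :
    Q {ω | y ≤ ∑ i ∈ Finset.Ico s n, A.observed f i ω} ≤
      ENNReal.ofReal (Real.exp (-y)) * Q Set.univ := by
  have h_exp_meas (a : Fin K) : Measurable fun x => ENNReal.ofReal (Real.exp (f a x)) :=
    (hf a).exp.ennreal_ofReal
  have h_exp_sum (ω : Observations K 𝓧) :
      ENNReal.ofReal (Real.exp (∑ i ∈ Finset.Ico s n, A.observed f i ω)) =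
        ∏ i ∈ Finset.Ico s n,
          A.observed (fun a x => ENNReal.ofReal (Real.exp (f a x))) i ω := by
    rw [Real.exp_sum, ENNReal.ofReal_prod_of_nonneg fun _ _ => Real.exp_nonneg _]
    rfl
  have h_meas : Measurable fun ω => ∏ i ∈ Finset.Ico s n,
      A.observed (fun a x => ENNReal.ofReal (Real.exp (f a x))) i ω :=
    Finset.measurable_fun_prod _ fun i hi => (A.measurable_observed h_exp_meas
      ((Nat.succ_le_of_lt (t.zero_le.trans_lt hs)).trans (Finset.mem_Ico.1 hi).1) le_rfl).mono
        (A.history_le i) le_rfl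
  have h_markov : ENNReal.ofReal (Real.exp y) *
      Q {ω | y ≤ ∑ i ∈ Finset.Ico s n, A.observed f i ω} ≤ Q Set.univ := by
    refine le_trans ?_ ((mul_meas_ge_le_lintegral h_meas (ENNReal.ofReal (Real.exp y))).trans
      (hQ.lintegral_prod_observed_le h_exp_meas hf_le hs n))
    gcongr with ω
    intro hω
    rw [← h_exp_sum]
    gcongr
  calc Q {ω | y ≤ ∑ i ∈ Finset.Ico s n, A.observed f i ω}
      = ENNReal.ofReal (Real.exp (-y)) * (ENNReal.ofReal (Real.exp y) *
          Q {ω | y ≤ ∑ i ∈ Finset.Ico s n, A.observed f i ω}) := by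
        rw [← mul_assoc, ← ENNReal.ofReal_mul (Real.exp_nonneg _), ← Real.exp_add,
          neg_add_cancel, Real.exp_zero, ENNReal.ofReal_one, one_mul]
    _ ≤ ENNReal.ofReal (Real.exp (-y)) * Q Set.univ := by gcongr

variable (M : Channels K 𝓧) {W n : ℕ} {a : Fin K}

lemma pulls_lt (hW : 0 < W) (α : ℕ → Fin K) (n : ℕ) (a : Fin K) : pulls W α n a < W := by
  calc pulls W α n a ≤ n - ((n - 1) / W * W + 1) := by
        simpa [pulls, intervalStart] using Finset.card_filter_le (Finset.Ico _ n) (α · = a)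
    _ ≤ (n - 1) % W := by
        rw [← Nat.sub_sub, Nat.sub_right_comm, Nat.sub_le_iff_le_add]
        exact (Nat.mod_add_div' (n - 1) W).ge
    _ < W := Nat.mod_lt _ hW

lemma sum_observed_single_affine (θ x c : ℝ) (ω : Observations K 𝓧) :
    ∑ i ∈ Finset.Ico (intervalStart W n) n,
        A.observed (Pi.single a fun y => θ * (M.llr a y - x) + c) i ω =
      pulls W (A.act · ω) n a * (θ * (meanReward M W ω (A.act · ω) n a - x) + c) := by
  have h_reward : pulls W (A.act · ω) n a * meanReward M W ω (A.act · ω) n a =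
      ∑ i ∈ Finset.Ico (intervalStart W n) n,
        if A.act i ω = a then M.llr (A.act i ω) (ω (i, A.act i ω)) else 0 := by
    refine mul_div_cancel_of_imp' fun h_pulls => Finset.sum_eq_zero fun i hi => ?_
    have h_zero := Finset.sum_eq_zero_iff.1 (Nat.cast_eq_zero.1 h_pulls) i hi
    grind
  have h_term (i : ℕ) : A.observed (Pi.single a fun y => θ * (M.llr a y - x) + c) i ω =
      θ * (if A.act i ω = a then M.llr (A.act i ω) (ω (i, A.act i ω)) else 0) +
        (c - θ * x) * if A.act i ω = a then 1 else 0 := by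
    by_cases h : A.act i ω = a
    · simp only [ControlPolicy.observed, h, Pi.single_eq_same, if_true]
      ring
    · simp [ControlPolicy.observed, h]
  have h_pulls : ∑ i ∈ Finset.Ico (intervalStart W n) n, (if A.act i ω = a then (1 : ℝ) else 0) =
      pulls W (A.act · ω) n a := by simp [pulls]
  simp only [h_term, Finset.sum_add_distrib, ← Finset.mul_sum, ← h_reward, h_pulls]
  ring

variable [∀ a, IsProbabilityMeasure (q a)]

lemma measure_le_pulls_mul_le (hQ : FreshAfter A q t Q) (hn : t < intervalStart W n) {θ x c : ℝ}
    (h : ∫⁻ y, ENNReal.ofReal (Real.exp (θ * (M.llr a y - x) + c)) ∂q a ≤ 1) (y : ℝ) :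
    Q {ω | y ≤ pulls W (A.act · ω) n a *
        (θ * (meanReward M W ω (A.act · ω) n a - x) + c)} ≤
      ENNReal.ofReal (Real.exp (-y)) * Q Set.univ := by
  simp only [← sum_observed_single_affine]
  refine hQ.measure_le_sum_observed_le (fun b => ?_) (fun b => ?_) hn n y
  · rcases eq_or_ne b a with rfl | hb
    · rw [Pi.single_eq_same]
      exact (((M.measurable_llr b).sub_const x).const_mul θ).add_const c
    · rw [Pi.single_eq_of_ne hb]
      exact measurable_const
  · rcases eq_or_ne b a with rfl | hb
    · simpa only [Pi.single_eq_same] using h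
    · simp [Pi.single_eq_of_ne hb]

lemma measure_le_meanReward_le (hQ : FreshAfter A q t Q) (hn : t < intervalStart W n)
    {θ x c : ℝ} (hθ : 0 ≤ θ) (hc : 0 ≤ c)
    (h : ∫⁻ y, ENNReal.ofReal (Real.exp (θ * (M.llr a y - x) + c)) ∂q a ≤ 1) (u : ℕ) :
    Q {ω | u ≤ pulls W (A.act · ω) n a ∧ x ≤ meanReward M W ω (A.act · ω) n a} ≤
      ENNReal.ofReal (Real.exp (-(c * u))) * Q Set.univ := by
  refine (measure_mono fun ω hω => ?_).trans (measure_le_pulls_mul_le M hQ hn h (c * u))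
  have h_pulls : (u : ℝ) ≤ pulls W (A.act · ω) n a := Nat.cast_le.2 hω.1
  have h_gap := mul_nonneg hθ (sub_nonneg.2 hω.2)
  calc c * u = u * c := mul_comm _ _
    _ ≤ pulls W (A.act · ω) n a * (θ * (meanReward M W ω (A.act · ω) n a - x) + c) := by
      gcongr
      linarith

variable {v : ℝ≥0} {x : ℝ}

lemma measure_pulls_eq_and_ucbIndex_le_le (hQ : FreshAfter A q t Q) (hn : t < intervalStart W n)
    (hv : 0 < v) (hsub : HasSubgaussianMGF (fun y => M.llr a y - x) v (q a)) {k : ℕ}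
    (hk : 0 < k) :
    Q {ω | pulls W (A.act · ω) n a = k ∧ ucbIndex M v W ω (A.act · ω) n a ≤ x} ≤
      ENNReal.ofReal (Real.exp (-(2 * Real.log W))) * Q Set.univ := by
  have : (0 : ℝ) < k := Nat.cast_pos.2 hk
  have : (0 : ℝ) < v := hv
  obtain ⟨s, hs_def⟩ : ∃ s, s = √(4 * v * Real.log W / k) := ⟨_, rfl⟩
  have hs : 0 ≤ s := hs_def ▸ Real.sqrt_nonneg _
  have hs_sq : s ^ 2 = 4 * v * Real.log W / k := by
    rw [hs_def, Real.sq_sqrt (by have := Real.log_natCast_nonneg W; positivity)]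
  -- `-s / v` minimizes `v θ² / 2 + θ s`, and the minimum is `-s² / (2 v) = -2 log W / k`.
  have h_exp : ∫⁻ y, ENNReal.ofReal
      (Real.exp (-(s / v) * (M.llr a y - x) + -(s ^ 2 / (2 * v)))) ∂q a ≤ 1 :=
    lintegral_exp_mul_add_le_one_of_hasSubgaussianMGF hsub
      (le_of_eq (by field_simp; ring))
  refine (measure_mono fun ω hω => ?_).trans
    (measure_le_pulls_mul_le M hQ hn h_exp (2 * Real.log W))
  obtain ⟨h_pulls, h_index⟩ := hω
  rw [ucbIndex, h_pulls, if_neg hk.ne', EReal.coe_le_coe_iff, ← hs_def] at h_index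
  rw [Set.mem_ofPred_eq, h_pulls]
  calc 2 * Real.log W = k * (-(s / v) * -s + -(s ^ 2 / (2 * v))) := by
        have : s ^ 2 * k = 4 * v * Real.log W := by rw [hs_sq]; field_simp
        field_simp
        linarith
    _ ≤ k * (-(s / v) * (meanReward M W ω (A.act · ω) n a - x) + -(s ^ 2 / (2 * v))) := by
        gcongr ?_ * (?_ + _)
        exact mul_le_mul_of_nonpos_left (by linarith) (neg_nonpos.2 (by positivity))

lemma measure_ucbIndex_le_le (hQ : FreshAfter A q t Q) (hn : t < intervalStart W n)
    (hv : 0 < v) (hsub : HasSubgaussianMGF (fun y => M.llr a y - x) v (q a)) (hW : 0 < W) :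
    Q {ω | ucbIndex M v W ω (A.act · ω) n a ≤ x} ≤ (W : ℝ≥0∞)⁻¹ * Q Set.univ := by
  have hW' : (0 : ℝ) < W := Nat.cast_pos.2 hW
  have h_exp : ENNReal.ofReal (Real.exp (-(2 * Real.log W))) = (W : ℝ≥0∞)⁻¹ * (W : ℝ≥0∞)⁻¹ := by
    rw [two_mul, neg_add, Real.exp_add, Real.exp_neg, Real.exp_log hW',
      ENNReal.ofReal_mul (by positivity), ENNReal.ofReal_inv_of_pos hW', ENNReal.ofReal_natCast]
  calc Q {ω | ucbIndex M v W ω (A.act · ω) n a ≤ x}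
      ≤ Q (⋃ k ∈ Finset.Icc 1 W,
          {ω | pulls W (A.act · ω) n a = k ∧ ucbIndex M v W ω (A.act · ω) n a ≤ x}) := by
        refine measure_mono fun ω hω => ?_
        have h_pulls : pulls W (A.act · ω) n a ≠ 0 := fun h => by
          simp [ucbIndex, h] at hω
        exact Set.mem_biUnion (Finset.mem_coe.2 (Finset.mem_Icc.2
          ⟨Nat.one_le_iff_ne_zero.2 h_pulls, (pulls_lt hW _ n a).le⟩)) ⟨rfl, hω⟩
    _ ≤ ∑ k ∈ Finset.Icc 1 W,
          Q {ω | pulls W (A.act · ω) n a = k ∧ ucbIndex M v W ω (A.act · ω) n a ≤ x} :=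
        measure_biUnion_finset_le _ _
    _ ≤ ∑ _k ∈ Finset.Icc 1 W, (W : ℝ≥0∞)⁻¹ * (W : ℝ≥0∞)⁻¹ * Q Set.univ := by
        refine Finset.sum_le_sum fun k hk => ?_
        rw [← h_exp]
        exact measure_pulls_eq_and_ucbIndex_le_le M hQ hn hv hsub (Finset.mem_Icc.1 hk).1
    _ = (W : ℝ≥0∞)⁻¹ * Q Set.univ := by
        rw [Finset.sum_const, Nat.card_Icc, add_tsub_cancel_right, nsmul_eq_mul, ← mul_assoc,
          ← mul_assoc, ENNReal.mul_inv_cancel (by simpa using hW.ne') (ENNReal.natCast_ne_top W),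
          one_mul]

end Concentration

section Regret

variable (M : Channels K 𝓧) {v : ℝ≥0} {W n u : ℕ} {tie : Finset (Fin K) → Fin K}

lemma ucbIndex_le_ucbIndex_act (htie : ∀ s : Finset (Fin K), s.Nonempty → tie s ∈ s) (n : ℕ)
    (ω : Observations K 𝓧) (b : Fin K) :
    ucbIndex M v W ω ((ucbPolicy M v W tie).act · ω) n b ≤
      ucbIndex M v W ω ((ucbPolicy M v W tie).act · ω) n ((ucbPolicy M v W tie).act n ω) := by
  have h_nonempty : (ucbArgmax M v W ω (ucbAct M v W tie · ω) n).Nonempty := by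
    obtain ⟨a, -, ha⟩ := Finset.exists_max_image Finset.univ
      (ucbIndex M v W ω (ucbAct M v W tie · ω) n) ⟨b, Finset.mem_univ b⟩
    exact ⟨a, Finset.mem_filter.2 ⟨Finset.mem_univ a, fun b => ha b (Finset.mem_univ b)⟩⟩
  have h_mem := htie _ h_nonempty
  rw [← ucbAct_eq M v W tie n ω] at h_mem
  exact (Finset.mem_filter.1 h_mem).2 b

lemma sub_le_meanReward {ω : Observations K 𝓧} {α : ℕ → Fin K} {a : Fin K} {x δ : ℝ} (hu : 0 < u)
    (hδ : 0 ≤ δ) (hδu : 4 * v * Real.log W ≤ δ ^ 2 * u) (h_pulls : u ≤ pulls W α n a)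
    (h_index : x ≤ ucbIndex M v W ω α n a) : x - δ ≤ meanReward M W ω α n a := by
  have h_pos : 0 < pulls W α n a := hu.trans_le h_pulls
  have h_bonus : √(4 * v * Real.log W / pulls W α n a) ≤ δ := by
    refine Real.sqrt_le_iff.2 ⟨hδ, (div_le_iff₀ (Nat.cast_pos.2 h_pos)).2 (hδu.trans ?_)⟩
    gcongr
  rw [ucbIndex, if_neg h_pos.ne', EReal.coe_le_coe_iff] at h_index
  linarith

/-- The `k`-th interval between two restarts of the UCB rule, counted from `k = 0`. -/
def interval (W k : ℕ) : Finset ℕ := Finset.Ico (k * W + 1) ((k + 1) * W + 1)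

lemma card_interval (W k : ℕ) : (interval W k).card = W := by
  rw [interval, Nat.card_Ico, add_one_mul]
  omega

lemma intervalStart_eq_of_mem_interval {k : ℕ} (hn : n ∈ interval W k) :
    intervalStart W n = k * W + 1 := by
  obtain ⟨h_left, h_right⟩ := Finset.mem_Ico.1 hn
  rw [intervalStart, show (n - 1) / W = k from Nat.div_eq_of_lt_le (by omega) (by omega)]

lemma pos_of_mem_interval {k : ℕ} (hn : n ∈ interval W k) : 1 ≤ n :=
  (Nat.le_add_left 1 _).trans (Finset.mem_Ico.1 hn).1

variable {Q : Measure (Observations K 𝓧)} {a : Fin K}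

lemma sum_measure_act_eq_and_pulls_lt_le (A : ControlPolicy K 𝓧) (k : ℕ) (a : Fin K) (u : ℕ) :
    ∑ n ∈ interval W k, Q {ω | A.act n ω = a ∧ pulls W (A.act · ω) n a < u} ≤
      u * Q Set.univ := by
  classical
  have h_act (i : ℕ) (hi : 1 ≤ i) : MeasurableSet {ω | A.act i ω = a} :=
    A.measurable_act_of_pos hi (measurableSet_singleton a)
  refine sum_measure_le_natCast_mul (fun n hn => ?_) fun ω => ?_
  · refine (h_act n (pos_of_mem_interval hn)).inter
      (measurableSet_lt (f := fun ω => pulls W (A.act · ω) n a) ?_ measurable_const)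
    refine Finset.measurable_fun_sum _ fun i hi => Measurable.ite ?_ measurable_const
      measurable_const
    exact h_act i ((Nat.le_add_left 1 _).trans (Finset.mem_Ico.1 hi).1)
  · refine le_trans (le_of_eq (congrArg _ (Finset.filter_congr fun n hn => ?_)))
      (card_filter_and_card_filter_lt_le (A.act · ω = a) (k * W + 1) ((k + 1) * W + 1) u)
    rw [Set.mem_ofPred_eq, pulls, intervalStart_eq_of_mem_interval hn, ← Finset.card_filter]

variable {q : Fin K → Measure 𝓧} [∀ a, IsProbabilityMeasure (q a)] {k : ℕ} {b : Fin K}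
  {x δ θ c : ℝ}

-- A stream that is already well sampled is selected only if it looks much better than it is, or if
-- the index of `b` lies below the mean reward `x` of `b`.
lemma measure_act_eq_and_le_pulls_le (hQ : FreshAfter (ucbPolicy M v W tie) q (k * W) Q)
    (htie : ∀ s : Finset (Fin K), s.Nonempty → tie s ∈ s) (hv : 0 < v) (hW : 0 < W)
    (hsub : HasSubgaussianMGF (fun y => M.llr b y - x) v (q b))
    (hδ : 0 ≤ δ) (hθ : 0 ≤ θ) (hc : 0 ≤ c)
    (h : ∫⁻ y, ENNReal.ofReal (Real.exp (θ * (M.llr a y - (x - δ)) + c)) ∂q a ≤ 1)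
    (hu : 0 < u) (hδu : 4 * v * Real.log W ≤ δ ^ 2 * u) (hn : n ∈ interval W k) :
    Q {ω | (ucbPolicy M v W tie).act n ω = a ∧
        u ≤ pulls W ((ucbPolicy M v W tie).act · ω) n a} ≤
      (ENNReal.ofReal (Real.exp (-(c * u))) + (W : ℝ≥0∞)⁻¹) * Q Set.univ := by
  have hn' : k * W < intervalStart W n := by
    rw [intervalStart_eq_of_mem_interval hn]
    exact Nat.lt_succ_self _
  rw [add_mul]
  refine (measure_mono fun ω hω => ?_).trans ((measure_union_le _ _).trans (add_le_add
    (measure_le_meanReward_le M hQ hn' hθ hc h u) (measure_ucbIndex_le_le M hQ hn' hv hsub hW)))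
  obtain ⟨h_act, h_pulls⟩ := hω
  rcases le_total (ucbIndex M v W ω ((ucbPolicy M v W tie).act · ω) n b) x with h_index | h_index
  · exact Or.inr h_index
  · refine Or.inl ⟨h_pulls, sub_le_meanReward M hu hδ hδu h_pulls (h_index.trans ?_)⟩
    exact (ucbIndex_le_ucbIndex_act M htie n ω b).trans_eq (by rw [h_act])

lemma sum_measure_act_eq_le (hQ : FreshAfter (ucbPolicy M v W tie) q (k * W) Q)
    (htie : ∀ s : Finset (Fin K), s.Nonempty → tie s ∈ s) (hv : 0 < v) (hW : 0 < W)
    (hsub : HasSubgaussianMGF (fun y => M.llr b y - x) v (q b))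
    (hδ : 0 ≤ δ) (hθ : 0 ≤ θ) (hc : 0 ≤ c)
    (h : ∫⁻ y, ENNReal.ofReal (Real.exp (θ * (M.llr a y - (x - δ)) + c)) ∂q a ≤ 1)
    (hu : 0 < u) (hδu : 4 * v * Real.log W ≤ δ ^ 2 * u) :
    ∑ n ∈ interval W k, Q ((ucbPolicy M v W tie).act n ⁻¹' {a}) ≤
      ENNReal.ofReal (u + W * Real.exp (-(c * u)) + 1) * Q Set.univ := by
  set A := ucbPolicy M v W tie
  calc ∑ n ∈ interval W k, Q (A.act n ⁻¹' {a})
      ≤ ∑ n ∈ interval W k, (Q {ω | A.act n ω = a ∧ pulls W (A.act · ω) n a < u} +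
          Q {ω | A.act n ω = a ∧ u ≤ pulls W (A.act · ω) n a}) := by
        refine Finset.sum_le_sum fun n _ => (measure_mono fun ω hω => ?_).trans
          (measure_union_le _ _)
        exact (lt_or_ge _ u).imp (⟨hω, ·⟩) (⟨hω, ·⟩)
    _ ≤ u * Q Set.univ + ∑ _n ∈ interval W k,
          (ENNReal.ofReal (Real.exp (-(c * u))) + (W : ℝ≥0∞)⁻¹) * Q Set.univ := by
        rw [Finset.sum_add_distrib]
        exact add_le_add (sum_measure_act_eq_and_pulls_lt_le A k a u) (Finset.sum_le_sum fun n hn =>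
          measure_act_eq_and_le_pulls_le M hQ htie hv hW hsub hδ hθ hc h hu hδu hn)
    _ = ENNReal.ofReal (u + W * Real.exp (-(c * u)) + 1) * Q Set.univ := by
        rw [Finset.sum_const, card_interval, nsmul_eq_mul, ← mul_assoc, ← add_mul, mul_add,
          ENNReal.mul_inv_cancel (by simpa using hW.ne') (ENNReal.natCast_ne_top W), ← add_assoc,
          ENNReal.ofReal_add (by positivity) zero_le_one, ENNReal.ofReal_add (by positivity)
          (by positivity), ENNReal.ofReal_mul (by positivity), ENNReal.ofReal_natCast,
          ENNReal.ofReal_natCast, ENNReal.ofReal_one]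

lemma eventually_sum_measureReal_act_eq_le
    (htie : ∀ s : Finset (Fin K), s.Nonempty → tie s ∈ s) (hv : 0 < v)
    (hsub : HasSubgaussianMGF (fun y => M.llr b y - x) v (q b))
    (hδ : 0 < δ) (hθ : 0 ≤ θ) (hc : 0 < c)
    (h : ∫⁻ y, ENNReal.ofReal (Real.exp (θ * (M.llr a y - (x - δ)) + c)) ∂q a ≤ 1)
    {ε : ℝ} (hε : 0 < ε) :
    ∀ᶠ W : ℕ in atTop, ∀ (k : ℕ) (Q : Measure (Observations K 𝓧)) [IsFiniteMeasure Q],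
      FreshAfter (ucbPolicy M v W tie) q (k * W) Q →
      ∑ n ∈ interval W k, Q.real ((ucbPolicy M v W tie).act n ⁻¹' {a}) ≤
        ε * (W * Q.real Set.univ) := by
  filter_upwards [eventually_gt_atTop 0, eventually_exists_log_le_mul_and_add_exp_le
    (C := 4 * v) (sq_pos_of_pos hδ) hc hε] with W hW ⟨u, hu, hδu, huε⟩ k Q _ hQ
  have h_le := sum_measure_act_eq_le M hQ htie hv hW hsub hδ.le hθ hc.le h hu hδu
  calc ∑ n ∈ interval W k, Q.real ((ucbPolicy M v W tie).act n ⁻¹' {a})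
      = (∑ n ∈ interval W k, Q ((ucbPolicy M v W tie).act n ⁻¹' {a})).toReal :=
        (ENNReal.toReal_sum fun _ _ => measure_ne_top Q _).symm
    _ ≤ (ENNReal.ofReal (u + W * Real.exp (-(c * u)) + 1) * Q Set.univ).toReal :=
        ENNReal.toReal_mono (by finiteness) h_le
    _ = (u + W * Real.exp (-(c * u)) + 1) * Q.real Set.univ := by
        rw [ENNReal.toReal_mul, ENNReal.toReal_ofReal (by positivity), measureReal_def]
    _ ≤ ε * W * Q.real Set.univ := by gcongr
    _ = ε * (W * Q.real Set.univ) := mul_assoc _ _ _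

end Regret

section Drift

/-- The sum of the values of `f` at the observations made in the `k`-th interval. -/
def ControlPolicy.intervalSum (A : ControlPolicy K 𝓧) (f : Fin K → 𝓧 → ℝ) (W k : ℕ)
    (ω : Observations K 𝓧) : ℝ :=
  ∑ n ∈ interval W k, A.observed f n ω

lemma exists_eq_succ_of_mem_interval {W k n : ℕ} (hn : n ∈ interval W k) :
    ∃ m, k * W ≤ m ∧ n = m + 1 := by
  have := (Finset.mem_Ico.1 hn).1
  exact ⟨n - 1, by omega, by omega⟩

namespace FreshAfter

variable {A : ControlPolicy K 𝓧} {q : Fin K → Measure 𝓧} {W k : ℕ} {Q : Measure (Observations K 𝓧)}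
  [IsFiniteMeasure Q] {f : Fin K → 𝓧 → ℝ}

lemma integrable_intervalSum (hQ : FreshAfter A q (k * W) Q) (hf : ∀ a, Integrable (f a) (q a)) :
    Integrable (A.intervalSum f W k) Q := by
  refine integrable_finsetSum _ fun n hn => ?_
  obtain ⟨n, hkn, rfl⟩ := exists_eq_succ_of_mem_interval hn
  exact hQ.integrable_observed hf hkn

lemma integral_intervalSum (hQ : FreshAfter A q (k * W) Q) (hf : ∀ a, Integrable (f a) (q a)) :
    ∫ ω, A.intervalSum f W k ω ∂Q =
      ∑ a, (∑ n ∈ interval W k, Q.real (A.act n ⁻¹' {a})) * ∫ x, f a x ∂q a := by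
  simp only [ControlPolicy.intervalSum, Finset.sum_mul]
  rw [Finset.sum_comm, integral_finsetSum]
  · refine Finset.sum_congr rfl fun n hn => ?_
    obtain ⟨n, hkn, rfl⟩ := exists_eq_succ_of_mem_interval hn
    exact hQ.integral_observed hf hkn
  · intro n hn
    obtain ⟨n, hkn, rfl⟩ := exists_eq_succ_of_mem_interval hn
    exact hQ.integrable_observed hf hkn

end FreshAfter

lemma sum_sum_measureReal_act_eq (A : ControlPolicy K 𝓧) (W k : ℕ) (Q : Measure (Observations K 𝓧))
    [IsFiniteMeasure Q] :
    ∑ a, ∑ n ∈ interval W k, Q.real (A.act n ⁻¹' {a}) = W * Q.real Set.univ := by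
  rw [Finset.sum_comm, Finset.sum_congr rfl fun n hn => ?_, Finset.sum_const, card_interval,
    nsmul_eq_mul]
  rw [sum_measureReal_preimage_singleton _ fun a _ =>
    A.measurable_act_of_pos (pos_of_mem_interval hn) (measurableSet_singleton a),
    Finset.coe_univ, Set.preimage_univ]

variable (M : Channels K 𝓧) {v : ℝ≥0} {tie : Finset (Fin K) → Fin K} {𝒜 : Finset (Fin K)}
  {h𝒜 : 𝒜.Nonempty}

lemma eventually_sum_measureReal_act_eq_le_of_kl_lt
    (hsupp : ∀ a, ∀ᵐ x ∂M.base, M.pre a x = 0 ↔ M.post a x = 0)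
    (hsub : ∀ a, HasSubgaussianMGF (fun x => M.llr a x - M.kl a) v (M.postMeasure a))
    (htie : ∀ s : Finset (Fin K), s.Nonempty → tie s ∈ s) (hI : 0 < M.maxKl 𝒜 h𝒜) {a : Fin K}
    (ha : a ∈ 𝒜 → M.kl a < M.maxKl 𝒜 h𝒜) {ε : ℝ} (hε : 0 < ε) :
    ∀ᶠ W : ℕ in atTop, ∀ (k : ℕ) (Q : Measure (Observations K 𝓧)) [IsFiniteMeasure Q],
      FreshAfter (ucbPolicy M v W tie) (M.changedMeasure 𝒜) (k * W) Q →
      ∑ n ∈ interval W k, Q.real ((ucbPolicy M v W tie).act n ⁻¹' {a}) ≤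
        ε * (W * Q.real Set.univ) := by
  obtain ⟨b, hb, hIb⟩ : ∃ b ∈ 𝒜, M.maxKl 𝒜 h𝒜 = M.kl b := Finset.exists_mem_eq_sup' h𝒜 M.kl
  have hv : 0 < v := by
    have := M.kl_le_half (hsub b) (hsupp b)
    exact NNReal.coe_pos.1 (by linarith)
  obtain ⟨δ, hδ, c, hc, θ, hθ, h⟩ :=
    M.exists_lintegral_exp_llr_changedMeasure_le_one 𝒜 hI hv (hsupp a) (hsub a) ha
  refine eventually_sum_measureReal_act_eq_le M htie hv ?_ hδ hθ.le hc h hε (b := b)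
  rw [M.changedMeasure_of_mem hb, hIb]
  exact hsub b

lemma exists_eventually_le_integral_intervalSum
    (hsupp : ∀ a, ∀ᵐ x ∂M.base, M.pre a x = 0 ↔ M.post a x = 0)
    (hsub : ∀ a, HasSubgaussianMGF (fun x => M.llr a x - M.kl a) v (M.postMeasure a))
    (htie : ∀ s : Finset (Fin K), s.Nonempty → tie s ∈ s) (hI : 0 < M.maxKl 𝒜 h𝒜) {m : ℝ}
    (hm : m < M.maxKl 𝒜 h𝒜) :
    ∃ B : ℝ, 0 ≤ B ∧ ∀ᶠ W : ℕ in atTop,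
      ∀ (k : ℕ) (Q : Measure (Observations K 𝓧)) [IsFiniteMeasure Q],
        FreshAfter (ucbPolicy M v W tie) (M.changedMeasure 𝒜) (k * W) Q →
        W * m * Q.real Set.univ ≤
          ∫ ω, (ucbPolicy M v W tie).intervalSum (fun a x => min (M.llr a x) B) W k ω ∂Q := by
  obtain ⟨J, hmJ, hJI⟩ := exists_between hm
  obtain ⟨B, hB, hBε⟩ := M.exists_le_integral_min_llr hsub (sub_pos.2 hJI)
  have h_int (a : Fin K) : Integrable (fun x => min (M.llr a x) B) (M.changedMeasure 𝒜 a) :=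
    (M.integrable_llr_changedMeasure 𝒜 (hsub a) (hsupp a)).inf (integrable_const B)
  set d : Fin K → ℝ := fun a => ∫ x, min (M.llr a x) B ∂M.changedMeasure 𝒜 a
  obtain ⟨η, hη, hηm⟩ : ∃ η > 0, m ≤ J - η * ∑ a, |d a - J| := by
    refine ⟨(J - m) / (∑ a, |d a - J| + 1), by have := sub_pos.2 hmJ; positivity, ?_⟩
    rw [le_sub_comm, div_mul_eq_mul_div, div_le_iff₀ (by positivity)]
    nlinarith
  have h_rare : ∀ᶠ W : ℕ in atTop, ∀ a, (a ∈ 𝒜 → M.kl a < M.maxKl 𝒜 h𝒜) →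
      ∀ (k : ℕ) (Q : Measure (Observations K 𝓧)) [IsFiniteMeasure Q],
        FreshAfter (ucbPolicy M v W tie) (M.changedMeasure 𝒜) (k * W) Q →
        ∑ n ∈ interval W k, Q.real ((ucbPolicy M v W tie).act n ⁻¹' {a}) ≤
          η * (W * Q.real Set.univ) :=
    eventually_all.2 fun a => eventually_imp_distrib_left.2 fun ha =>
      eventually_sum_measureReal_act_eq_le_of_kl_lt M hsupp hsub htie hI ha hη
  refine ⟨B, hB, h_rare.mono fun W h_rare k Q _ hQ => ?_⟩
  rw [hQ.integral_intervalSum h_int, mul_right_comm, mul_comm,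
    ← sum_sum_measureReal_act_eq (ucbPolicy M v W tie) W k Q]
  refine (mul_le_mul_of_nonneg_right hηm (by positivity)).trans (sub_mul_sum_le_sum_mul
    (fun a => by positivity) hη.le fun a => ?_)
  by_cases ha : a ∈ 𝒜 ∧ M.maxKl 𝒜 h𝒜 ≤ M.kl a
  · refine Or.inl ((by linarith : J ≤ M.kl a - (M.maxKl 𝒜 h𝒜 - J)).trans ((hBε a).trans_eq ?_))
    simp only [d, M.changedMeasure_of_mem ha.1]
  · rw [sum_sum_measureReal_act_eq]
    exact Or.inr (h_rare a (fun h => not_le.1 fun h' => ha ⟨h, h'⟩) k Q hQ)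

end Drift

section Delay

variable (M : Channels K 𝓧) (A : ControlPolicy K 𝓧) {W : ℕ} {B b m : ℝ}

lemma sum_observed_min_llr_le_max_cusum (B : ℝ) (s n : ℕ) (ω : Observations K 𝓧) :
    ∑ i ∈ Finset.Ico (s + 1) (n + 1), A.observed (fun a x => min (M.llr a x) B) i ω ≤
      max (cusum M A n ω) 0 := by
  induction n with
  | zero => simp
  | succ n ih =>
    rcases le_or_gt s n with hsn | hsn
    · rw [Finset.sum_Ico_succ_top (by omega), cusum]
      exact (add_le_add ih (min_le_left _ _)).trans (le_max_left _ _)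
    · rw [Finset.Ico_eq_empty (by omega), Finset.sum_empty]
      exact le_max_right _ _

lemma sum_intervalSum (f : Fin K → 𝓧 → ℝ) (W k₀ k : ℕ) (ω : Observations K 𝓧) :
    ∑ j ∈ Finset.range k, A.intervalSum f W (k₀ + j) ω =
      ∑ i ∈ Finset.Ico (k₀ * W + 1) ((k₀ + k) * W + 1), A.observed f i ω := by
  induction k with
  | zero => simp
  | succ k ih =>
    rw [Finset.sum_range_succ, ih, ControlPolicy.intervalSum, interval,
      Finset.sum_Ico_consecutive, add_assoc]
    · exact Nat.succ_le_succ (Nat.mul_le_mul_right W (Nat.le_add_right k₀ k))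
    · exact Nat.succ_le_succ (Nat.mul_le_mul_right W (Nat.le_succ _))

lemma measurable_intervalSum {f : Fin K → 𝓧 → ℝ} (hf : ∀ a, Measurable (f a)) {k n : ℕ}
    (hn : (k + 1) * W ≤ n) : Measurable[history A.act n] (A.intervalSum f W k) := by
  refine Finset.measurable_fun_sum _ fun i hi =>
    A.measurable_observed hf (pos_of_mem_interval hi) ?_
  have := (Finset.mem_Ico.1 hi).2
  omega

lemma alarmTime_le_of_le_sum_intervalSum (hb : 0 < b) {k₀ k : ℕ} {ω : Observations K 𝓧}
    (h : b ≤ ∑ j ∈ Finset.range k,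
      A.intervalSum (fun a x => min (M.llr a x) B) W (k₀ + j) ω) :
    alarmTime M A b ω ≤ ((k₀ + k) * W : ℕ) := by
  rw [sum_intervalSum] at h
  have h_cusum : b ≤ cusum M A ((k₀ + k) * W) ω :=
    (le_max_iff.1 (h.trans (sum_observed_min_llr_le_max_cusum M A B (k₀ * W) _ ω))).resolve_right
      hb.not_ge
  refine hittingAfter_le_of_mem (Nat.one_le_iff_ne_zero.2 fun h_zero => ?_) h_cusum
  rw [h_zero, cusum] at h_cusum
  exact hb.not_ge h_cusum

lemma alarmTime_add_one_sub_le (hb : 0 < b) (hW : 0 < W) {k₀ ν : ℕ} (hk₀ : k₀ * W + 1 ≤ ν + W)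
    (ω : Observations K 𝓧) :
    (alarmTime M A b ω : ℝ≥0∞) + 1 - ν ≤ W + W * (sumHittingTime
      (fun j => A.intervalSum (fun a x => min (M.llr a x) B) W (k₀ + j)) b ω : ℝ≥0∞) := by
  cases h : sumHittingTime (fun j => A.intervalSum (fun a x => min (M.llr a x) B) W (k₀ + j)) b ω
  with
  | top => simp [hW.ne']
  | coe k =>
    have h_alarm : (alarmTime M A b ω : ℝ≥0∞) ≤ ((k₀ + k) * W : ℕ) := by
      simpa using ENat.toENNReal_le.2
        (alarmTime_le_of_le_sum_intervalSum M A hb (le_of_hittingAfter_Ici_eq h))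
    rw [tsub_le_iff_right]
    calc (alarmTime M A b ω : ℝ≥0∞) + 1 ≤ ((k₀ + k) * W : ℕ) + 1 := by gcongr
      _ = (k₀ * W + 1 + k * W : ℕ) := by push_cast; ring
      _ ≤ (ν + W + k * W : ℕ) := by gcongr
      _ = W + W * (k : ℝ≥0∞) + ν := by push_cast; ring
      _ = _ := by simp

lemma exists_le_mul_add_one_le (hW : 0 < W) (ν : ℕ) :
    ∃ k, ν ≤ k * W + 1 ∧ k * W + 1 ≤ ν + W := by
  refine ⟨(ν - 1 + (W - 1)) / W, ?_, ?_⟩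
  · have := Nat.lt_div_mul_add (a := ν - 1 + (W - 1)) hW
    omega
  · have := Nat.div_mul_le_self (ν - 1 + (W - 1)) W
    omega

variable {q : Fin K → Measure 𝓧}

lemma lintegral_sumHittingTime_intervalSum_le {f : Fin K → 𝓧 → ℝ} (hf : ∀ a, Measurable (f a))
    (hf_int : ∀ a, Integrable (f a) (q a)) (hf_le : ∀ a x, f a x ≤ B) (hB : 0 ≤ B) (hb : 0 ≤ b)
    (hm : 0 < m) (hW : 0 < W)
    (h_drift : ∀ (k : ℕ) (Q : Measure (Observations K 𝓧)) [IsFiniteMeasure Q],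
      FreshAfter A q (k * W) Q → W * m * Q.real Set.univ ≤ ∫ ω, A.intervalSum f W k ω ∂Q)
    {k₀ : ℕ} {Q : Measure (Observations K 𝓧)} [IsFiniteMeasure Q]
    (hQ : FreshAfter A q (k₀ * W) Q) :
    ∫⁻ ω, (sumHittingTime (fun j => A.intervalSum f W (k₀ + j)) b ω : ℝ≥0∞) ∂Q ≤
      ENNReal.ofReal ((b + W * B) / (W * m)) * Q Set.univ := by
  have h_fresh (k : ℕ) : FreshAfter A q ((k₀ + k) * W) Q := hQ.mono (by gcongr; omega)
  refine lintegral_sumHittingTime_le (by positivity) (by positivity) (fun k ω => ?_)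
    (fun k => (measurable_intervalSum A hf le_rfl).mono (A.history_le _) le_rfl)
    (fun k => (h_fresh k).integrable_intervalSum hf_int) fun k => ?_
  · refine (Finset.sum_le_card_nsmul _ _ B fun i _ => hf_le _ _).trans_eq ?_
    rw [card_interval, nsmul_eq_mul]
  · have h_meas : MeasurableSet[history A.act ((k₀ + k) * W)]
        {ω | (k : ℕ∞) < sumHittingTime (fun j => A.intervalSum f W (k₀ + j)) b ω} :=
      @measurableSet_lt_sumHittingTime _ _ _ (history A.act _) _ fun i hi =>
        measurable_intervalSum A hf (Nat.mul_le_mul_right W (by omega))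
    simpa only [measureReal_restrict_apply_univ] using
      h_drift (k₀ + k) _ ((h_fresh k).restrict h_meas)

lemma worstCaseDelay_le {v : ℝ≥0} {𝒜 : Finset (Fin K)}
    (hsupp : ∀ a, ∀ᵐ x ∂M.base, M.pre a x = 0 ↔ M.post a x = 0)
    (hsub : ∀ a, HasSubgaussianMGF (fun x => M.llr a x - M.kl a) v (M.postMeasure a))
    (hB : 0 ≤ B) (hb : 0 < b) (hm : 0 < m) (hW : 0 < W)
    (h_drift : ∀ (k : ℕ) (Q : Measure (Observations K 𝓧)) [IsFiniteMeasure Q],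
      FreshAfter A (M.changedMeasure 𝒜) (k * W) Q →
      W * m * Q.real Set.univ ≤ ∫ ω, A.intervalSum (fun a x => min (M.llr a x) B) W k ω ∂Q) :
    worstCaseDelay M 𝒜 A (alarmTime M A b) ≤ ENNReal.ofReal (W + (b + W * B) / m) := by
  refine iSup₂_le fun ν hν => essSup_condLExp_le (A.history_le _) fun G hG => ?_
  obtain ⟨k₀, hνk₀, hk₀ν⟩ := exists_le_mul_add_one_le hW ν
  have hQ : FreshAfter A (M.changedMeasure 𝒜) (k₀ * W) ((M.law 𝒜 ν).restrict G) :=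
    ((M.freshAfter_law A 𝒜 ν).restrict hG).mono (by omega)
  set Q := (M.law 𝒜 ν).restrict G
  have hQ_univ : Q Set.univ = M.law 𝒜 ν G := Measure.restrict_apply_univ G
  set τ := sumHittingTime (fun j => A.intervalSum (fun a x => min (M.llr a x) B) W (k₀ + j)) b
  calc ∫⁻ ω, (alarmTime M A b ω : ℝ≥0∞) + 1 - ν ∂Q
      ≤ ∫⁻ ω, W + W * (τ ω : ℝ≥0∞) ∂Q :=
        lintegral_mono fun ω => alarmTime_add_one_sub_le M A hb hW hk₀ν ω
    _ = W * Q Set.univ + W * ∫⁻ ω, (τ ω : ℝ≥0∞) ∂Q := by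
        rw [lintegral_add_left measurable_const, lintegral_const,
          lintegral_const_mul' _ _ (ENNReal.natCast_ne_top W)]
    _ ≤ W * Q Set.univ + W * (ENNReal.ofReal ((b + W * B) / (W * m)) * Q Set.univ) := by
        gcongr
        exact lintegral_sumHittingTime_intervalSum_le A
          (fun a => (M.measurable_llr a).min measurable_const)
          (fun a => (M.integrable_llr_changedMeasure 𝒜 (hsub a) (hsupp a)).inf
            (integrable_const B)) (fun _ _ => min_le_right _ _) hB hb.le hm hW h_drift hQ
    _ = ENNReal.ofReal (W + (b + W * B) / m) * M.law 𝒜 ν G := by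
        rw [hQ_univ, ← mul_assoc, ← add_mul, ← ENNReal.ofReal_natCast,
          ← ENNReal.ofReal_mul W.cast_nonneg, ← ENNReal.ofReal_add W.cast_nonneg (by positivity)]
        congr 3
        field_simp

lemma add_div_le_div_mul_one_add {w I ε : ℝ} (hI : 0 < I) (hε : 0 < ε) (hB : 0 ≤ B)
    (hw : w ≤ ε / (2 * I * (1 + B * (1 + ε / 2) / I)) * b) :
    w + (b + w * B) / (I / (1 + ε / 2)) ≤ b / I * (1 + ε) := by
  have hc : 0 < 1 + B * (1 + ε / 2) / I := by positivity
  calc w + (b + w * B) / (I / (1 + ε / 2))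
      = b / I * (1 + ε / 2) + w * (1 + B * (1 + ε / 2) / I) := by field_simp; ring
    _ ≤ b / I * (1 + ε / 2) +
        ε / (2 * I * (1 + B * (1 + ε / 2) / I)) * b * (1 + B * (1 + ε / 2) / I) := by gcongr
    _ = b / I * (1 + ε) := by
        generalize 1 + B * (1 + ε / 2) / I = c at hc
        field_simp
        ring

lemma eventually_worstCaseDelay_le {v : ℝ≥0} {tie : Finset (Fin K) → Fin K}
    {𝒜 : Finset (Fin K)} {h𝒜 : 𝒜.Nonempty}
    (hsupp : ∀ a, ∀ᵐ x ∂M.base, M.pre a x = 0 ↔ M.post a x = 0)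
    (hsub : ∀ a, HasSubgaussianMGF (fun x => M.llr a x - M.kl a) v (M.postMeasure a))
    (htie : ∀ s : Finset (Fin K), s.Nonempty → tie s ∈ s) (hI : 0 < M.maxKl 𝒜 h𝒜) {ι : Type*}
    {l : Filter ι} {b : ι → ℝ} {W : ι → ℕ} (hb : Tendsto b l atTop) (hW : Tendsto W l atTop)
    (hWb : (fun i => (W i : ℝ)) =o[l] b) {ε : ℝ} (hε : 0 < ε) :
    ∀ᶠ i in l, worstCaseDelay M 𝒜 (ucbPolicy M v (W i) tie)
        (alarmTime M (ucbPolicy M v (W i) tie) (b i)) ≤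
      ENNReal.ofReal (b i / M.maxKl 𝒜 h𝒜 * (1 + ε)) := by
  obtain ⟨B, hB, h_drift⟩ := exists_eventually_le_integral_intervalSum M hsupp hsub htie hI
    (div_lt_self hI (by linarith : 1 < 1 + ε / 2))
  filter_upwards [hW.eventually h_drift, hW.eventually_gt_atTop 0, hb.eventually_gt_atTop 0,
    hWb.bound (c := ε / (2 * M.maxKl 𝒜 h𝒜 * (1 + B * (1 + ε / 2) / M.maxKl 𝒜 h𝒜)))
      (by positivity)] with i h_drift hW hb hWb
  rw [Real.norm_natCast, Real.norm_of_nonneg hb.le] at hWb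
  exact (worstCaseDelay_le M _ hsupp hsub hB hb (by positivity) hW h_drift).trans
    (ENNReal.ofReal_le_ofReal (add_div_le_div_mul_one_add hI hε hB hWb))

end Delay

end BanditQCD

end

theorem theorem1_general {K : ℕ} {𝓧 : Type*} [MeasurableSpace 𝓧] (M : BanditQCD.Channels K 𝓧)
    (hsupp : ∀ a, ∀ᵐ x ∂M.base, M.pre a x = 0 ↔ M.post a x = 0)
    (v : ℝ≥0)
    (hsub : ∀ a, HasSubgaussianMGF (fun x => M.llr a x - M.kl a) v (M.postMeasure a))
    (tie : Finset (Fin K) → Fin K) (htie : ∀ s : Finset (Fin K), s.Nonempty → tie s ∈ s) :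
    (∀ (A : BanditQCD.ControlPolicy K 𝓧) (γ : ℝ), 0 < γ →
      ENNReal.ofReal γ ≤
        BanditQCD.meanTimeToFalseAlarm M (BanditQCD.alarmTime M A (Real.log γ))) ∧
    (∀ (𝒜 : Finset (Fin K)) (h𝒜 : 𝒜.Nonempty), 0 < M.maxKl 𝒜 h𝒜 →
      ∀ {ι : Type*} (l : Filter ι) (γ : ι → ℝ) (W : ι → ℕ),
      Tendsto γ l atTop → Tendsto W l atTop →
      (fun i => (W i : ℝ)) =o[l] (fun i => Real.log (γ i)) →
      ∃ r : ι → ℝ, Tendsto r l (𝓝 0) ∧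
        ∀ᶠ i in l,
          BanditQCD.worstCaseDelay M 𝒜 (BanditQCD.ucbPolicy M v (W i) tie)
              (BanditQCD.alarmTime M (BanditQCD.ucbPolicy M v (W i) tie) (Real.log (γ i))) ≤
            ENNReal.ofReal (Real.log (γ i) / M.maxKl 𝒜 h𝒜 * (1 + r i))) := by
  refine ⟨fun A γ hγ => ?_, fun 𝒜 h𝒜 hI ι l γ W hγ hW hWγ => ?_⟩
  · simpa only [Real.exp_log hγ] using
      BanditQCD.ofReal_exp_le_meanTimeToFalseAlarm M A hsupp (Real.log γ)
  · have h_log : Tendsto (fun i => Real.log (γ i)) l atTop := Real.tendsto_log_atTop.comp hγ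
    exact BanditQCD.exists_tendsto_zero_le_ofReal
      ((h_log.eventually_gt_atTop 0).mono fun _ h_pos => div_pos h_pos hI) fun ε hε =>
        BanditQCD.eventually_worstCaseDelay_le M hsupp hsub htie hI h_log hW hWγ hε

theorem theorem1 {K : ℕ} {𝓧 : Type*} [MeasurableSpace 𝓧] (M : BanditQCD.Channels K 𝓧)
    (hsupp : ∀ a, ∀ᵐ x ∂M.base, M.pre a x = 0 ↔ M.post a x = 0)
    (hkl : ∀ a, 0 < M.kl a)
    (v : ℝ≥0)
    (hsub : ∀ a, HasSubgaussianMGF (fun x => M.llr a x - M.kl a) v (M.postMeasure a))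
    (tie : Finset (Fin K) → Fin K) (htie : ∀ s : Finset (Fin K), s.Nonempty → tie s ∈ s) :
    (∀ (γ : ℝ) (W : ℕ), 0 < γ → 0 < W →
      ENNReal.ofReal γ ≤ BanditQCD.meanTimeToFalseAlarm M
        (BanditQCD.alarmTime M (BanditQCD.ucbPolicy M v W tie) (Real.log γ))) ∧
    (∀ (𝒜 : Finset (Fin K)) (h𝒜 : 𝒜.Nonempty) {ι : Type*} (l : Filter ι) (γ : ι → ℝ) (W : ι → ℕ),
      Tendsto γ l atTop → Tendsto W l atTop →
      (fun i => (W i : ℝ)) =o[l] (fun i => Real.log (γ i)) →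
      ∃ r : ι → ℝ, Tendsto r l (𝓝 0) ∧
        ∀ᶠ i in l,
          BanditQCD.worstCaseDelay M 𝒜 (BanditQCD.ucbPolicy M v (W i) tie)
              (BanditQCD.alarmTime M (BanditQCD.ucbPolicy M v (W i) tie) (Real.log (γ i))) ≤
            ENNReal.ofReal (Real.log (γ i) / M.maxKl 𝒜 h𝒜 * (1 + r i))) := by
  obtain ⟨h_alarm, h_delay⟩ := theorem1_general M hsupp v hsub tie htie
  exact ⟨fun γ _ hγ _ => h_alarm _ γ hγ, fun 𝒜 h𝒜 => h_delay 𝒜 h𝒜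
    ((hkl _).trans_le (Finset.le_sup' M.kl h𝒜.choose_spec))⟩
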